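/- Let $\eta,\theta>0$, $\eta\ne\theta$, $0<\gamma\le 1$ and $\beta\ge 0$. For $b,h>0$ let $\mathcal P^{b}([0,h])$ be the set of probability measures on $[0,h]$ that are absolutely continuous with density at most $\frac1{bx}$, and let $\mathcal P^{0}([0,h])=\mathcal P([0,h])$. Put $\ln 0=-\infty$. **Equilibrium measure.** For $\xi\in(-\gamma^2,1)$ let $\kappa=\gamma^2-|\xi|$ if $\xi\le 0$, $\kappa=\gamma^2$ if $0<\xi\le 1-\gamma^2$, and $\kappa=1-\xi$ if $\xi>1-\gamma^2$ and $\xi>0$. The *equilibrium measure* $\mu$ of the Muttalib–Borodin slice at time $\xi$ is the unique minimizer over $\mathcal P^{\beta\kappa}([0,e^{-\beta(\gamma^2-\kappa)}])$ of the rate function $$I^{(\xi)}(\mu)=-\frac{\kappa^2}{2}\iint\bigl(\ln|x^\theta-y^\theta|+\ln|x^\eta-y^\eta|\bigr)\,d\mu(x)\,d\mu(y)-K^{(\xi)}(\mu)-M^{(\xi)}(\mu),$$ where * if $\xi\in(-\gamma^2,0]$: $K^{(\xi)}(\mu)=\kappa\int\int_{\gamma^2-1}^{|\xi|}\ln(1-x^\theta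 e^{\beta\theta u})\,du\,d\mu(x)$ and $M^{(\xi)}(\mu)=\kappa\eta|\xi|\int\ln x\,d\mu(x)$; * if $\xi\in(0,1-\gamma^2]$: $K^{(\xi)}(\mu)=\kappa\int\int_0^{1-\gamma^2-\xi}\ln(1-x^\theta e^{-\beta\theta u})\,du\,d\mu(x)$ and $M^{(\xi)}(\mu)=\kappa\theta\xi\int\ln x\,d\mu(x)$; * if $\xi\in(1-\gamma^2,1)$ and $\xi>0$: $K^{(\xi)}(\mu)=\kappa\int\int_{1-\gamma^2-\xi}^{0}\ln(1-x^\eta e^{-\beta\eta u})\,du\,d\mu(x)$ and $M^{(\xi)}(\mu)=\kappa\theta\xi\int\ln x\,d\mu(x)$. **Model problems.** Given parameters $\nu>1$, $\kappa,\alpha,\rho>0$, $m_1\ge0$, $n_1\le n_2$, Model Problem 1 asks for the minimizer $\omega_\nu$ over $\omega\in\mathcal P^{\beta\rho\kappa}([0,e^{-\rho\beta(\gamma^2-\kappa)}])$ of $$-\frac12\int_0^1\!\!\int_0^1\bigl(\ln|x^\nu-y^\nu|+\ln|x-y|\bigr)\omega(dx)\,\omega(dy)-\frac1\kappa\int_0^1\!\!\int_{n_1}^{n_2}\ln(1-x^{\nu}e^{-\beta\alpha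 u})\,du\,\omega(dx)-m_1\int_0^1\ln x\,\omega(dx),$$ under the assumption $n_1\alpha=-\nu\rho(\gamma^2-\kappa)$. Model Problem 2 asks for the minimizer $\omega_1$, over the same set, of the same functional with $\ln(1-x^\nu e^{-\beta\alpha u})$ replaced by $\ln(1-xe^{-\beta\alpha u})$, under the assumption $n_1\alpha=-\rho(\gamma^2-\kappa)$. **Claim.** In each case below, the listed parameters satisfy the assumptions of the indicated model problem, this model problem has a unique minimizer $\omega$ ($=\omega_\nu$ or $\omega_1$), the equilibrium measure $\mu$ exists and is unique, and $\mu$ is the pushforward of $\omega$ under $y\mapsto y^{1/\zeta}$, with $\zeta=\eta$ if $\theta>\eta$ and $\zeta=\theta$ if $\eta>\theta$. In terms of densities, $\mu(x)=\zeta x^{\zeta-1}\omega(x^\zeta)$ for almost every $x>0$ (for $\beta=0$ this is an identity between the densities of the absolutely continuous parts). Case 1: $\theta>\eta$; $\zeta=\eta$, $\nu=\theta/\eta$, $\rho=\eta$. * (i) $\xi\in(-\gamma^2,0]$: Model Problem 1 with $\kappa=\gamma^2-|\xi|$, $m_1=\frac{|\xi|}{\kappa}$, $n_1=-|\xi|$,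 $n_2=1-\gamma^2$, $\alpha=\theta$. * (ii) $\xi\in(0,1-\gamma^2]$: Model Problem 1 with $\kappa=\gamma^2$, $m_1=\frac{\theta\xi}{\eta\kappa}$, $n_1=0$, $n_2=1-\gamma^2-\xi$, $\alpha=\theta$. * (iii) $\xi\in(1-\gamma^2,1)$: Model Problem 2 with $\kappa=1-\xi$, $m_1=\frac{\theta\xi}{\eta\kappa}$, $n_1=1-\gamma^2-\xi$, $n_2=0$, $\alpha=\eta$. Case 2: $\eta>\theta$; $\zeta=\theta$, $\nu=\eta/\theta$, $\rho=\theta$. * (i) $\xi\in(-\gamma^2,0]$: Model Problem 2 with $\kappa=\gamma^2-|\xi|$, $m_1=\frac{|\xi|\eta}{\kappa\theta}$, $n_1=-|\xi|$, $n_2=1-\gamma^2$, $\alpha=\theta$. * (ii) $\xi\in(0,1-\gamma^2]$: Model Problem 2 with $\kappa=\gamma^2$, $m_1=\frac{\xi}{\kappa}$, $n_1=0$, $n_2=1-\gamma^2-\xi$, $\alpha=\theta$. * (iii) $\xi\in(1-\gamma^2,1)$: Model Problem 1 with $\kappa=1-\xi$, $m_1=\frac{\xi}{\kappa}$, $n_1=1-\gamma^2-\xi$,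 $n_2=0$, $\alpha=\eta$. -/

import Mathlib

open MeasureTheory Set
open scoped ENNReal

namespace MuttalibBorodin

/-- The function `-ln`, with the value `+∞` at `0`. In all functionals below it is applied to
numbers of `[0, 1]`, where `-ln` is nonnegative, so that energies take values in `[0, ∞]`. -/
noncomputable def negLog (x : ℝ) : ℝ≥0∞ :=
  if x ≤ 0 then ⊤ else ENNReal.ofReal (-Real.log x)

/-- The set `𝒫ᵇ([0, h])` of probability measures on `[0, h]` which have a density bounded by
`1 / (b x)`. For `b = 0` there is no constraint: `𝒫⁰([0, h]) = 𝒫([0, h])`. -/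
def constrainedMeasures (b h : ℝ) : Set (Measure ℝ) :=
  {μ | IsProbabilityMeasure μ ∧ μ (Icc 0 h)ᶜ = 0 ∧
    (0 < b → μ ≪ volume ∧
      ∀ᵐ x ∂volume, 0 < x → μ.rnDeriv volume x ≤ ENNReal.ofReal (1 / (b * x)))}

/-- `μ` is the unique minimizer of `F` over the set `C`. -/
def IsUniqueMinimizer (C : Set (Measure ℝ)) (F : Measure ℝ → ℝ≥0∞) (μ : Measure ℝ) : Prop :=
  μ ∈ C ∧ ∀ μ' ∈ C, μ' ≠ μ → F μ < F μ'

/-! ### The rate function of the slice at time `ξ` -/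

/-- The rescaled number `κ(ξ)` of particles of the slice at time `ξ`. -/
noncomputable def kappa (γ ξ : ℝ) : ℝ :=
  if ξ ≤ 0 then γ ^ 2 - |ξ| else if ξ ≤ 1 - γ ^ 2 then γ ^ 2 else 1 - ξ

/-- `-H`, the interaction energy. -/
noncomputable def interactionEnergy (γ η θ ξ : ℝ) (μ : Measure ℝ) : ℝ≥0∞ :=
  ENNReal.ofReal (kappa γ ξ ^ 2 / 2) *
    ∫⁻ x, ∫⁻ y, (negLog |x ^ θ - y ^ θ| + negLog |x ^ η - y ^ η|) ∂μ ∂μ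

/-- `-K`, the part of the potential energy that comes from the Pochhammer weights. -/
noncomputable def pochhammerEnergy (γ η θ β ξ : ℝ) (μ : Measure ℝ) : ℝ≥0∞ :=
  ENNReal.ofReal (kappa γ ξ) * ∫⁻ x,
    (if ξ ≤ 0 then
      ∫⁻ u in Ioc (γ ^ 2 - 1) |ξ|, negLog (1 - x ^ θ * Real.exp (β * θ * u))
    else if ξ ≤ 1 - γ ^ 2 then
      ∫⁻ u in Ioc 0 (1 - γ ^ 2 - ξ), negLog (1 - x ^ θ * Real.exp (-(β * θ * u)))
    else
      ∫⁻ u in Ioc (1 - γ ^ 2 - ξ) 0, negLog (1 - x ^ η * Real.exp (-(β * η * u)))) ∂μ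

/-- `-M`, the logarithmic part of the potential energy. -/
noncomputable def logEnergy (γ η θ ξ : ℝ) (μ : Measure ℝ) : ℝ≥0∞ :=
  ENNReal.ofReal (kappa γ ξ * (if ξ ≤ 0 then η * |ξ| else θ * ξ)) * ∫⁻ x, negLog x ∂μ

/-- The rate function `I = -H - K - M` of the slice at time `ξ`. -/
noncomputable def rateFunction (γ η θ β ξ : ℝ) (μ : Measure ℝ) : ℝ≥0∞ :=
  interactionEnergy γ η θ ξ μ + pochhammerEnergy γ η θ β ξ μ + logEnergy γ η θ ξ μ

/-- The set of limits of the empirical measures of the slice at time `ξ`, over which the rate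
function is minimized. -/
noncomputable def sliceMeasures (γ β ξ : ℝ) : Set (Measure ℝ) :=
  constrainedMeasures (β * kappa γ ξ) (Real.exp (-(β * (γ ^ 2 - kappa γ ξ))))

/-- `μ` is the equilibrium measure of the slice at time `ξ`. -/
def IsEquilibriumMeasure (γ η θ β ξ : ℝ) (μ : Measure ℝ) : Prop :=
  IsUniqueMinimizer (sliceMeasures γ β ξ) (rateFunction γ η θ β ξ) μ

/-! ### The two model problems -/

/-- The parameters of a model problem. -/
structure ModelParameters where
  ν : ℝ
  κ : ℝ
  m₁ : ℝ
  n₁ : ℝ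
  n₂ : ℝ
  α : ℝ
  ρ : ℝ

namespace ModelParameters

/-- The functional of the first model problem, with potential `ln (1 - x ^ ν e ^ (-β α u))`. -/
noncomputable def firstFunctional (p : ModelParameters) (β : ℝ) (ω : Measure ℝ) : ℝ≥0∞ :=
  ENNReal.ofReal (1 / 2) *
      ∫⁻ x in Icc 0 1, ∫⁻ y in Icc 0 1, (negLog |x ^ p.ν - y ^ p.ν| + negLog |x - y|) ∂ω ∂ω
    + ENNReal.ofReal (1 / p.κ) *
      ∫⁻ x in Icc 0 1, (∫⁻ u in Ioc p.n₁ p.n₂,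
        negLog (1 - x ^ p.ν * Real.exp (-(β * p.α * u)))) ∂ω
    + ENNReal.ofReal p.m₁ * ∫⁻ x in Icc 0 1, negLog x ∂ω

/-- The functional of the second model problem, with potential `ln (1 - x e ^ (-β α u))`. -/
noncomputable def secondFunctional (p : ModelParameters) (β : ℝ) (ω : Measure ℝ) : ℝ≥0∞ :=
  ENNReal.ofReal (1 / 2) *
      ∫⁻ x in Icc 0 1, ∫⁻ y in Icc 0 1, (negLog |x ^ p.ν - y ^ p.ν| + negLog |x - y|) ∂ω ∂ω
    + ENNReal.ofReal (1 / p.κ) *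
      ∫⁻ x in Icc 0 1, (∫⁻ u in Ioc p.n₁ p.n₂,
        negLog (1 - x * Real.exp (-(β * p.α * u)))) ∂ω
    + ENNReal.ofReal p.m₁ * ∫⁻ x in Icc 0 1, negLog x ∂ω

/-- The set `𝒫^{βρκ}([0, e^{-ρβ(γ² - κ)}])` of competitors in either model problem. -/
noncomputable def competitors (p : ModelParameters) (γ β : ℝ) : Set (Measure ℝ) :=
  constrainedMeasures (β * p.ρ * p.κ) (Real.exp (-(p.ρ * β * (γ ^ 2 - p.κ))))

/-- The standing assumptions common to both model problems. -/
def Standing (p : ModelParameters) : Prop :=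
  1 < p.ν ∧ 0 < p.κ ∧ 0 < p.α ∧ 0 < p.ρ ∧ 0 ≤ p.m₁ ∧ p.n₁ ≤ p.n₂

/-- The parameters are admissible for the first model problem: the last condition says that the
zero of `1 - x ^ ν e ^ (-β α n₁)` is the right end point of the interval of the competitors. -/
def FirstAdmissible (p : ModelParameters) (γ : ℝ) : Prop :=
  p.Standing ∧ p.n₁ * p.α = -(p.ν * p.ρ * (γ ^ 2 - p.κ))

/-- The parameters are admissible for the second model problem: the last condition says that the
zero of `1 - x e ^ (-β α n₁)` is the right end point of the interval of the competitors. -/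
def SecondAdmissible (p : ModelParameters) (γ : ℝ) : Prop :=
  p.Standing ∧ p.n₁ * p.α = -(p.ρ * (γ ^ 2 - p.κ))

/-- `ω` is the solution of the first model problem. -/
def IsFirstSolution (p : ModelParameters) (γ β : ℝ) (ω : Measure ℝ) : Prop :=
  IsUniqueMinimizer (p.competitors γ β) (p.firstFunctional β) ω

/-- `ω` is the solution of the second model problem. -/
def IsSecondSolution (p : ModelParameters) (γ β : ℝ) (ω : Measure ℝ) : Prop :=
  IsUniqueMinimizer (p.competitors γ β) (p.secondFunctional β) ω

end ModelParameters

/-- `μ` is the image of `ω` under `y ↦ y ^ (1 / ζ)`, and the densities satisfy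
`μ(x) = ζ x ^ (ζ - 1) ω(x ^ ζ)` for almost every `x > 0`. -/
def IsPowerPushforward (ζ : ℝ) (ω μ : Measure ℝ) : Prop :=
  μ = ω.map (fun y => y ^ (1 / ζ)) ∧
    ∀ᵐ x ∂volume, 0 < x →
      μ.rnDeriv volume x = ENNReal.ofReal (ζ * x ^ (ζ - 1)) * ω.rnDeriv volume (x ^ ζ)

/-- The first model problem with parameters `p` is admissible and has a solution, the slice at
time `ξ` has an equilibrium measure, and the latter is the transform of the former with
exponent `ζ`. -/
def RecoveredFromFirst (γ η θ β ξ ζ : ℝ) (p : ModelParameters) : Prop :=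
  p.FirstAdmissible γ ∧ ∃ ω μ : Measure ℝ, p.IsFirstSolution γ β ω ∧
    IsEquilibriumMeasure γ η θ β ξ μ ∧ IsPowerPushforward ζ ω μ

/-- The same for the second model problem. -/
def RecoveredFromSecond (γ η θ β ξ ζ : ℝ) (p : ModelParameters) : Prop :=
  p.SecondAdmissible γ ∧ ∃ ω μ : Measure ℝ, p.IsSecondSolution γ β ω ∧
    IsEquilibriumMeasure γ η θ β ξ μ ∧ IsPowerPushforward ζ ω μ

end MuttalibBorodin

/-!
On `[0, 1]` the kernel `-ln |x - y| = ∫₀¹ r⁻² (r - |x - y|)₊ dr + (1 - |x - y|)` is a superposition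
of products `1_I(x) 1_I(y)` over the intervals `I = (t, t + r)` with `0 < r ≤ 1`, so the logarithmic
energy of `μ` is an integral of `μ(I)²`. Hence it is midpoint convex, strictly so because the
lengths `r = 1` alone determine `μ`, which gives uniqueness; and it is lower semicontinuous for weak
convergence, which gives a minimizer over a weakly compact relaxation of the constraint. The
relaxation only forgets that there is no atom at `0`, which finite energy restores.

The power map `x ↦ x ^ ζ` carries the constraint `dx / (b x)` to `dx / (b ζ x)` and the rate
function of a slice to `κ²` times the functional of a model problem, hence minimizers to minimizers.
-/

namespace MuttalibBorodin

/-! ### The function `-ln` -/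

lemma negLog_zero : negLog 0 = ⊤ := by simp [negLog]

lemma negLog_of_pos {x : ℝ} (hx : 0 < x) : negLog x = ENNReal.ofReal (-Real.log x) := by
  simp [negLog, not_le.2 hx]

lemma antitone_negLog : Antitone negLog := by
  intro x y hxy
  rcases le_or_gt x 0 with hx | hx
  · simp [negLog, hx]
  · rw [negLog_of_pos hx, negLog_of_pos (hx.trans_le hxy)]
    exact ENNReal.ofReal_le_ofReal (neg_le_neg (Real.log_le_log hx hxy))

@[fun_prop]
lemma measurable_negLog : Measurable negLog := antitone_negLog.measurable

lemma lowerSemicontinuous_negLog : LowerSemicontinuous negLog := by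
  intro x c hc
  rcases le_or_gt x 0 with hx | hx
  · have hct : c < ⊤ := hc.trans_le le_top
    have hlt : x < Real.exp (-(c.toReal + 1)) := hx.trans_lt (Real.exp_pos _)
    filter_upwards [Iio_mem_nhds hlt] with y hy
    refine lt_of_lt_of_le ?_ (antitone_negLog (le_of_lt hy))
    rw [negLog_of_pos (Real.exp_pos _), Real.log_exp, neg_neg,
      ENNReal.lt_ofReal_iff_toReal_lt hct.ne]
    exact lt_add_one _
  · have hcont : ContinuousAt (fun y => ENNReal.ofReal (-Real.log y)) x :=
      ENNReal.continuous_ofReal.continuousAt.comp (Real.continuousAt_log hx.ne').neg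
    rw [negLog_of_pos hx] at hc
    filter_upwards [hcont.eventually (lt_mem_nhds hc), Ioi_mem_nhds hx] with y hy hy0
    rwa [negLog_of_pos hy0]

lemma negLog_rpow {x p : ℝ} (hx : 0 ≤ x) (hp : 0 < p) :
    negLog (x ^ p) = ENNReal.ofReal p * negLog x := by
  rcases hx.eq_or_lt with rfl | hx
  · rw [Real.zero_rpow hp.ne', negLog_zero, ENNReal.mul_top (by simpa using hp)]
  · rw [negLog_of_pos hx, negLog_of_pos (Real.rpow_pos_of_pos hx p), Real.log_rpow hx,
      ← ENNReal.ofReal_mul hp.le, mul_neg]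

/-! ### The logarithmic kernel as a superposition of products of indicator functions -/

lemma integral_sub_div_sq {d : ℝ} (hd : 0 < d) (hd1 : d ≤ 1) :
    ∫ r in d..1, (r - d) / r ^ 2 = -Real.log d - (1 - d) := by
  have hne : ∀ r ∈ uIcc d 1, r ≠ 0 := fun r hr => by
    rw [uIcc_of_le hd1] at hr
    exact (hd.trans_le hr.1).ne'
  have hderiv : ∀ r ∈ uIcc d 1,
      HasDerivAt (fun r => Real.log r + d * r⁻¹) ((r - d) / r ^ 2) r := fun r hr => by
    have hr0 := hne r hr
    refine ((Real.hasDerivAt_log hr0).add ((hasDerivAt_inv hr0).const_mul d)).congr_deriv ?_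
    field_simp
    ring
  have hcont : ContinuousOn (fun r : ℝ => (r - d) / r ^ 2) (uIcc d 1) :=
    ContinuousOn.div (by fun_prop) (by fun_prop) fun r hr => pow_ne_zero 2 (hne r hr)
  rw [intervalIntegral.integral_eq_sub_of_hasDerivAt hderiv hcont.intervalIntegrable,
    mul_inv_cancel₀ hd.ne', Real.log_one]
  ring

lemma lintegral_inv_sq_mul_sub_of_pos {d : ℝ} (hd : 0 < d) (hd1 : d ≤ 1) :
    ∫⁻ r in Ioc 0 1, ENNReal.ofReal (1 / r ^ 2) * ENNReal.ofReal (r - d) =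
      ENNReal.ofReal (-Real.log d - (1 - d)) := by
  have hcont : ContinuousOn (fun r : ℝ => (r - d) / r ^ 2) (Icc d 1) :=
    ContinuousOn.div (by fun_prop) (by fun_prop) fun r hr => pow_ne_zero 2 (hd.trans_le hr.1).ne'
  have hzero : ∫⁻ r in Ioc 0 d, ENNReal.ofReal (1 / r ^ 2) * ENNReal.ofReal (r - d) = 0 := by
    rw [setLIntegral_congr_fun (g := fun _ => 0) measurableSet_Ioc, lintegral_zero]
    intro r hr
    simp only [ENNReal.ofReal_of_nonpos (sub_nonpos.2 hr.2), mul_zero]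
  calc ∫⁻ r in Ioc 0 1, ENNReal.ofReal (1 / r ^ 2) * ENNReal.ofReal (r - d)
      = ∫⁻ r in Ioc d 1, ENNReal.ofReal (1 / r ^ 2) * ENNReal.ofReal (r - d) := by
        rw [← Ioc_union_Ioc_eq_Ioc hd.le hd1,
          lintegral_union measurableSet_Ioc (Ioc_disjoint_Ioc_of_le le_rfl), hzero, zero_add]
    _ = ∫⁻ r in Ioc d 1, ENNReal.ofReal ((r - d) / r ^ 2) := by
        refine lintegral_congr fun r => ?_
        rw [← ENNReal.ofReal_mul (by positivity), one_div_mul_eq_div]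
    _ = ENNReal.ofReal (∫ r in d..1, (r - d) / r ^ 2) := by
        rw [intervalIntegral.integral_of_le hd1, ofReal_integral_eq_lintegral_ofReal]
        · exact hcont.integrableOn_Icc.mono_set Ioc_subset_Icc_self
        · filter_upwards [ae_restrict_mem measurableSet_Ioc] with r hr
          exact div_nonneg (sub_nonneg.2 hr.1.le) (sq_nonneg r)
    _ = ENNReal.ofReal (-Real.log d - (1 - d)) := by rw [integral_sub_div_sq hd hd1]

lemma lintegral_inv_sq_mul_sub_add {d : ℝ} (hd : 0 ≤ d) (hd1 : d ≤ 1) :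
    (∫⁻ r in Ioc 0 1, ENNReal.ofReal (1 / r ^ 2) * ENNReal.ofReal (r - d))
      + ENNReal.ofReal (1 - d) = negLog d := by
  have hpos : ∀ {d : ℝ}, 0 < d → d ≤ 1 →
      (∫⁻ r in Ioc 0 1, ENNReal.ofReal (1 / r ^ 2) * ENNReal.ofReal (r - d))
        + ENNReal.ofReal (1 - d) = negLog d := fun {d} hd hd1 => by
    rw [lintegral_inv_sq_mul_sub_of_pos hd hd1,
      ← ENNReal.ofReal_add (by linarith [Real.log_le_sub_one_of_pos hd]) (by linarith),
      sub_add_cancel, negLog_of_pos hd]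
  rcases hd.eq_or_lt with rfl | hd
  · -- The left-hand side decreases in `d` and its values at `d = exp (-c)` are unbounded.
    rw [negLog_zero, eq_top_iff]
    refine ENNReal.le_of_forall_nnreal_lt fun c _ => ?_
    calc (c : ℝ≥0∞) = negLog (Real.exp (-c)) := by
          rw [negLog_of_pos (Real.exp_pos _), Real.log_exp, neg_neg, ENNReal.ofReal_coe_nnreal]
      _ = _ := (hpos (Real.exp_pos _) (Real.exp_le_one_iff.2 (by simp))).symm
      _ ≤ _ := by gcongr <;> exact (Real.exp_pos _).le
  · exact hpos hd hd1

/-- The measure on the pairs `(r, t)` for which the logarithmic kernel on `[0, 1]` is the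
superposition of the products `1_I(x) 1_I(y)` over the intervals `I = (t, t + r)`: it is
`dr dt / r ^ 2` on `0 < r ≤ 1`, plus `dt` on the line `r = 1`. -/
noncomputable def kernelMeasure : Measure (ℝ × ℝ) :=
  ((volume.restrict (Ioc 0 1)).withDensity (fun r => ENNReal.ofReal (1 / r ^ 2))
    + Measure.dirac 1).prod volume

instance : SFinite kernelMeasure := by
  unfold kernelMeasure
  infer_instance

/-- The logarithmic energy of a measure on `[0, 1]`, written as a superposition of squares of the
measures of intervals. -/
noncomputable def intervalEnergy (μ : Measure ℝ) : ℝ≥0∞ :=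
  ∫⁻ p, μ (Ioo p.2 (p.2 + p.1)) ^ 2 ∂kernelMeasure

lemma lintegral_kernelMeasure {f : ℝ × ℝ → ℝ≥0∞} (hf : Measurable f) :
    ∫⁻ p, f p ∂kernelMeasure =
      (∫⁻ r in Ioc 0 1, ENNReal.ofReal (1 / r ^ 2) * ∫⁻ t, f (r, t)) + ∫⁻ t, f (1, t) := by
  rw [kernelMeasure, lintegral_prod _ hf.aemeasurable, lintegral_add_measure,
    lintegral_dirac' _ hf.lintegral_prod_right',
    lintegral_withDensity_eq_lintegral_mul _ (by fun_prop) hf.lintegral_prod_right']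
  rfl

lemma ae_ae_one_of_ae_kernelMeasure {q : ℝ × ℝ → Prop} (h : ∀ᵐ p ∂kernelMeasure, q p) :
    ∀ᵐ t, q (1, t) := by
  have hae := Measure.ae_ae_of_ae_prod h
  rw [ae_add_measure_iff, ae_dirac_eq, Filter.eventually_pure] at hae
  exact hae.2

lemma measurableSet_mem_interval :
    MeasurableSet {q : (ℝ × ℝ) × ℝ | q.2 ∈ Ioo q.1.2 (q.1.2 + q.1.1)} :=
  (measurableSet_lt (f := fun q : (ℝ × ℝ) × ℝ => q.1.2) (by fun_prop) measurable_snd).inter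
    (measurableSet_lt measurable_snd (by fun_prop))

lemma measurable_measure_interval (μ : Measure ℝ) [SFinite μ] :
    Measurable (fun p : ℝ × ℝ => μ (Ioo p.2 (p.2 + p.1))) :=
  measurable_measure_prodMk_left measurableSet_mem_interval

lemma measurable_indicator_interval :
    Measurable fun q : (ℝ × ℝ) × ℝ =>
      (Ioo q.1.2 (q.1.2 + q.1.1)).indicator (1 : ℝ → ℝ≥0∞) q.2 :=
  (measurable_const (a := (1 : ℝ≥0∞))).indicator measurableSet_mem_interval

lemma lintegral_indicator_interval_mul (x y r : ℝ) :
    ∫⁻ t, (Ioo t (t + r)).indicator 1 x * (Ioo t (t + r)).indicator 1 y =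
      ENNReal.ofReal (r - |x - y|) := by
  have hmem : ∀ t, t ∈ Ioo (max x y - r) (min x y) ↔ x ∈ Ioo t (t + r) ∧ y ∈ Ioo t (t + r) := by
    simp only [mem_Ioo, sub_lt_iff_lt_add, max_lt_iff, lt_min_iff]
    tauto
  have hprod : ∀ t, (Ioo t (t + r)).indicator (1 : ℝ → ℝ≥0∞) x * (Ioo t (t + r)).indicator 1 y
      = (Ioo (max x y - r) (min x y)).indicator 1 t := fun t => by
    simp only [indicator_apply, hmem t, Pi.one_apply, ite_and, mul_ite, mul_one, mul_zero]
    split_ifs <;> rfl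
  simp_rw [hprod]
  rw [lintegral_indicator_one measurableSet_Ioo, Real.volume_Ioo, ← max_sub_min_eq_abs' x y]
  congr 1
  ring

lemma negLog_abs_sub_eq_lintegral_kernelMeasure {x y : ℝ} (hx : x ∈ Icc (0 : ℝ) 1)
    (hy : y ∈ Icc (0 : ℝ) 1) :
    negLog |x - y| = ∫⁻ p, (Ioo p.2 (p.2 + p.1)).indicator 1 x *
      (Ioo p.2 (p.2 + p.1)).indicator 1 y ∂kernelMeasure := by
  have hm : ∀ x : ℝ, Measurable fun p : ℝ × ℝ =>
      (Ioo p.2 (p.2 + p.1)).indicator (1 : ℝ → ℝ≥0∞) x := fun x =>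
    measurable_indicator_interval.comp (measurable_prodMk_right (y := x))
  rw [lintegral_kernelMeasure (by exact (hm x).mul (hm y))]
  simp only [lintegral_indicator_interval_mul]
  rw [lintegral_inv_sq_mul_sub_add (abs_nonneg _)]
  rw [abs_le]
  constructor <;> linarith [hx.1, hx.2, hy.1, hy.2]

lemma lintegral_negLog_abs_sub {μ : Measure ℝ} [SFinite μ] (hμ : μ (Icc 0 1)ᶜ = 0) :
    ∫⁻ x, ∫⁻ y, negLog |x - y| ∂μ ∂μ = intervalEnergy μ := by
  have hae : ∀ᵐ x ∂μ, x ∈ Icc (0 : ℝ) 1 := hμ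
  have hm := measurable_indicator_interval
  calc ∫⁻ x, ∫⁻ y, negLog |x - y| ∂μ ∂μ
      = ∫⁻ x, ∫⁻ y, ∫⁻ p, (Ioo p.2 (p.2 + p.1)).indicator 1 x *
          (Ioo p.2 (p.2 + p.1)).indicator 1 y ∂kernelMeasure ∂μ ∂μ := by
        refine lintegral_congr_ae ?_
        filter_upwards [hae] with x hx
        refine lintegral_congr_ae ?_
        filter_upwards [hae] with y hy using negLog_abs_sub_eq_lintegral_kernelMeasure hx hy
    _ = ∫⁻ x, ∫⁻ p, (Ioo p.2 (p.2 + p.1)).indicator 1 x * μ (Ioo p.2 (p.2 + p.1))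
          ∂kernelMeasure ∂μ := by
        refine lintegral_congr fun x => ?_
        rw [lintegral_lintegral_swap]
        · refine lintegral_congr fun p => ?_
          rw [lintegral_const_mul _ (measurable_one.indicator measurableSet_Ioo),
            lintegral_indicator_one measurableSet_Ioo]
        · refine Measurable.aemeasurable ?_
          exact (hm.comp (f := fun q : ℝ × ℝ × ℝ => (q.2, x)) (by fun_prop)).mul
            (hm.comp (f := fun q : ℝ × ℝ × ℝ => (q.2, q.1)) (by fun_prop))
    _ = intervalEnergy μ := by
        rw [lintegral_lintegral_swap]
        · refine lintegral_congr fun p => ?_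
          rw [lintegral_mul_const _ (measurable_one.indicator measurableSet_Ioo),
            lintegral_indicator_one measurableSet_Ioo, sq]
        · refine Measurable.aemeasurable ?_
          exact (hm.comp (f := fun q : ℝ × ℝ × ℝ => (q.2, q.1)) (by fun_prop)).mul
            ((measurable_measure_interval μ).comp measurable_snd)

/-! ### Strict convexity of the energy -/

lemma measure_Iic_le_of_ae_measure_Ioo_eq {μ μ' : Measure ℝ} (hμ : μ (Icc 0 1)ᶜ = 0)
    (h : ∀ᵐ t : ℝ, μ (Ioo t (t + 1)) = μ' (Ioo t (t + 1))) {a b : ℝ} (hab : a < b) (hb : b < 1) :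
    μ (Iic a) ≤ μ' (Iic b) := by
  obtain ⟨t, ⟨hat, htb⟩, ht⟩ :
      ∃ t ∈ Ioo (a - 1) (b - 1), μ (Ioo t (t + 1)) = μ' (Ioo t (t + 1)) := by
    by_contra! hne
    have hzero : volume (Ioo (a - 1) (b - 1)) = 0 := measure_mono_null hne h
    rw [Real.volume_Ioo, ENNReal.ofReal_eq_zero] at hzero
    linarith
  calc μ (Iic a) ≤ μ (Ioo t (t + 1) ∪ (Icc 0 1)ᶜ) := by
        refine measure_mono fun x (hx : x ≤ a) => ?_
        simp only [mem_union, mem_Ioo, mem_compl_iff, mem_Icc]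
        grind
    _ ≤ μ (Ioo t (t + 1)) := (measure_union_le _ _).trans_eq (by rw [hμ, add_zero])
    _ = μ' (Ioo t (t + 1)) := ht
    _ ≤ μ' (Iic b) := measure_mono fun x hx => show x ≤ b by linarith [hx.2]

lemma measure_Iic_le_of_forall_gt {μ μ' : Measure ℝ} [IsFiniteMeasure μ'] {a c : ℝ} (hac : a < c)
    (h : ∀ b ∈ Ioo a c, μ (Iic a) ≤ μ' (Iic b)) : μ (Iic a) ≤ μ' (Iic a) := by
  have hlim : Filter.Tendsto (fun b => μ' (Iic b)) (nhdsWithin a (Ioi a)) (nhds (μ' (Iic a))) := by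
    have hInter : ⋂ b > a, Iic b = Iic a := by
      ext x
      simpa using forall_gt_imp_ge_iff_le_of_dense
    rw [← hInter]
    exact tendsto_measure_biInter_gt (fun _ _ => measurableSet_Iic.nullMeasurableSet)
      (fun _ _ _ => Iic_subset_Iic.2) ⟨a + 1, by simp, measure_ne_top _ _⟩
  refine ge_of_tendsto hlim ?_
  filter_upwards [Ioo_mem_nhdsGT hac] using h

lemma measure_Iic_eq_one {μ : Measure ℝ} [IsProbabilityMeasure μ] (hμ : μ (Icc 0 1)ᶜ = 0) {a : ℝ}
    (ha : 1 ≤ a) : μ (Iic a) = 1 := by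
  rw [← prob_compl_eq_zero_iff measurableSet_Iic]
  exact measure_mono_null (compl_subset_compl.2 fun x hx => hx.2.trans ha) hμ

lemma eq_of_ae_measure_Ioo_eq {μ μ' : Measure ℝ} [IsProbabilityMeasure μ]
    [IsProbabilityMeasure μ'] (hμ : μ (Icc 0 1)ᶜ = 0) (hμ' : μ' (Icc 0 1)ᶜ = 0)
    (h : ∀ᵐ t : ℝ, μ (Ioo t (t + 1)) = μ' (Ioo t (t + 1))) : μ = μ' := by
  refine Measure.ext_of_Iic _ _ fun a => ?_
  rcases le_or_gt 1 a with ha | ha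
  · rw [measure_Iic_eq_one hμ ha, measure_Iic_eq_one hμ' ha]
  · have h' := h.mono fun _ => Eq.symm
    exact le_antisymm
      (measure_Iic_le_of_forall_gt ha fun b hb =>
        measure_Iic_le_of_ae_measure_Ioo_eq hμ h hb.1 hb.2)
      (measure_Iic_le_of_forall_gt ha fun b hb =>
        measure_Iic_le_of_ae_measure_Ioo_eq hμ' h' hb.1 hb.2)

lemma two_mul_sq_half_add_le (a b : ℝ≥0∞) : 2 * (2⁻¹ * (a + b)) ^ 2 ≤ a ^ 2 + b ^ 2 := by
  rcases eq_or_ne a ⊤ with rfl | ha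
  · simp
  rcases eq_or_ne b ⊤ with rfl | hb
  · simp
  lift a to NNReal using ha
  lift b to NNReal using hb
  rw [← ENNReal.toReal_le_toReal (by finiteness) (by finiteness)]
  simp only [ENNReal.toReal_mul, ENNReal.toReal_ofNat, ENNReal.toReal_pow, ENNReal.toReal_inv,
    ne_eq, ENNReal.coe_ne_top, not_false_eq_true, ENNReal.toReal_add, ENNReal.coe_toReal,
    ENNReal.pow_eq_top_iff, OfNat.ofNat_ne_zero, and_true]
  nlinarith [sq_nonneg ((a : ℝ) - b)]

lemma eq_of_two_mul_sq_half_add_eq {a b : ℝ≥0∞} (ha : a ≠ ⊤) (hb : b ≠ ⊤)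
    (h : 2 * (2⁻¹ * (a + b)) ^ 2 = a ^ 2 + b ^ 2) : a = b := by
  lift a to NNReal using ha
  lift b to NNReal using hb
  have hreal := congrArg ENNReal.toReal h
  simp only [ENNReal.toReal_mul, ENNReal.toReal_ofNat, ENNReal.toReal_pow, ENNReal.toReal_inv,
    ne_eq, ENNReal.coe_ne_top, not_false_eq_true, ENNReal.toReal_add, ENNReal.coe_toReal,
    ENNReal.pow_eq_top_iff, OfNat.ofNat_ne_zero, and_true] at hreal
  have hsq : ((a : ℝ) - b) ^ 2 = 0 := by linear_combination -2 * hreal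
  exact_mod_cast sub_eq_zero.1 (pow_eq_zero_iff two_ne_zero |>.1 hsq)

/-- The midpoint `(μ + μ') / 2` of two measures. -/
noncomputable def measureMidpoint (μ μ' : Measure ℝ) : Measure ℝ := (2⁻¹ : ℝ≥0∞) • (μ + μ')

lemma measureMidpoint_apply (μ μ' : Measure ℝ) (s : Set ℝ) :
    measureMidpoint μ μ' s = 2⁻¹ * (μ s + μ' s) := rfl

lemma map_measureMidpoint {f : ℝ → ℝ} (hf : Measurable f) (μ μ' : Measure ℝ) :
    (measureMidpoint μ μ').map f = measureMidpoint (μ.map f) (μ'.map f) := by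
  rw [measureMidpoint, Measure.map_smul, Measure.map_add _ _ hf, measureMidpoint]

lemma two_mul_lintegral_measureMidpoint (V : ℝ → ℝ≥0∞) (μ μ' : Measure ℝ) :
    2 * ∫⁻ x, V x ∂(measureMidpoint μ μ') = ∫⁻ x, V x ∂μ + ∫⁻ x, V x ∂μ' := by
  rw [measureMidpoint, lintegral_smul_measure, lintegral_add_measure, smul_eq_mul,
    ENNReal.mul_inv_cancel_left two_ne_zero ENNReal.ofNat_ne_top]

lemma two_mul_intervalEnergy_measureMidpoint_le (μ μ' : Measure ℝ) [SFinite μ] :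
    2 * intervalEnergy (measureMidpoint μ μ') ≤ intervalEnergy μ + intervalEnergy μ' := by
  unfold intervalEnergy
  rw [← lintegral_const_mul' _ _ ENNReal.ofNat_ne_top,
    ← lintegral_add_left ((measurable_measure_interval μ).pow_const 2)]
  exact lintegral_mono fun p => two_mul_sq_half_add_le _ _

lemma two_mul_intervalEnergy_measureMidpoint_lt {μ μ' : Measure ℝ} [IsProbabilityMeasure μ]
    [IsProbabilityMeasure μ'] (hμ : μ (Icc 0 1)ᶜ = 0) (hμ' : μ' (Icc 0 1)ᶜ = 0)
    (hfin : intervalEnergy μ ≠ ⊤) (hfin' : intervalEnergy μ' ≠ ⊤) (hne : μ ≠ μ') :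
    2 * intervalEnergy (measureMidpoint μ μ') < intervalEnergy μ + intervalEnergy μ' := by
  have hm := measurable_measure_interval μ
  have hm' := measurable_measure_interval μ'
  set a : ℝ × ℝ → ℝ≥0∞ := fun p => μ (Ioo p.2 (p.2 + p.1))
  set a' : ℝ × ℝ → ℝ≥0∞ := fun p => μ' (Ioo p.2 (p.2 + p.1))
  have hsum : intervalEnergy μ + intervalEnergy μ' = ∫⁻ p, (a p ^ 2 + a' p ^ 2) ∂kernelMeasure :=
    (lintegral_add_left (hm.pow_const 2) _).symm
  have hmid : 2 * intervalEnergy (measureMidpoint μ μ') =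
      ∫⁻ p, 2 * (2⁻¹ * (a p + a' p)) ^ 2 ∂kernelMeasure :=
    (lintegral_const_mul' _ _ ENNReal.ofNat_ne_top).symm
  have hle := two_mul_intervalEnergy_measureMidpoint_le μ μ'
  have htop := ne_top_of_le_ne_top (ENNReal.add_ne_top.2 ⟨hfin, hfin'⟩) hle
  contrapose! hne
  rw [hsum, hmid] at hne
  have hae := ae_eq_of_ae_le_of_lintegral_le
    (Filter.Eventually.of_forall fun p => two_mul_sq_half_add_le (a p) (a' p))
    (hmid ▸ htop) ((hm.pow_const 2).add (hm'.pow_const 2)).aemeasurable hne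
  -- The atom of `kernelMeasure` at `r = 1` makes the squares agree on intervals of length one.
  refine eq_of_ae_measure_Ioo_eq hμ hμ' ?_
  filter_upwards [ae_ae_one_of_ae_kernelMeasure hae] with t ht
  exact eq_of_two_mul_sq_half_add_eq (measure_ne_top _ _) (measure_ne_top _ _) ht

/-! ### Lower semicontinuity -/

lemma lowerSemicontinuous_lintegral {X P : Type*} [TopologicalSpace X] [FirstCountableTopology X]
    [MeasurableSpace P] {τ : Measure P} {F : X → P → ℝ≥0∞} (hm : ∀ x, Measurable (F x))
    (hF : ∀ p, LowerSemicontinuous fun x => F x p) :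
    LowerSemicontinuous fun x => ∫⁻ p, F x p ∂τ := by
  rw [lowerSemicontinuous_iff_le_liminf]
  intro x
  exact (lintegral_mono fun p => lowerSemicontinuous_iff_le_liminf.1 (hF p) x).trans
    (lintegral_liminf_le hm)

lemma lintegral_indicator_ofReal_lt (c : ℝ≥0∞) :
    ∫⁻ t in Ioi (0 : ℝ), {t : ℝ | ENNReal.ofReal t < c}.indicator 1 t = c := by
  have hms : MeasurableSet {t : ℝ | ENNReal.ofReal t < c} :=
    measurableSet_lt ENNReal.measurable_ofReal measurable_const
  rw [lintegral_indicator_one hms, Measure.restrict_apply hms]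
  rcases eq_or_ne c ⊤ with rfl | hc
  · simp
  · have hIoo : {t : ℝ | ENNReal.ofReal t < c} ∩ Ioi 0 = Ioo 0 c.toReal := by
      ext t
      rw [mem_inter_iff, and_comm]
      exact and_congr_right fun ht => ENNReal.ofReal_lt_iff_lt_toReal (le_of_lt ht) hc
    rw [hIoo, Real.volume_Ioo, sub_zero, ENNReal.ofReal_toReal hc]

lemma lintegral_eq_lintegral_measure_ofReal_lt {X : Type*} [MeasurableSpace X] {V : X → ℝ≥0∞}
    (hV : Measurable V) (μ : Measure X) [SFinite μ] :
    ∫⁻ x, V x ∂μ = ∫⁻ t in Ioi (0 : ℝ), μ (V ⁻¹' Ioi (ENNReal.ofReal t)) := by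
  have hms : MeasurableSet {q : X × ℝ | ENNReal.ofReal q.2 < V q.1} :=
    measurableSet_lt (by fun_prop) (by fun_prop)
  have hmi : Measurable (Function.uncurry fun (x : X) (t : ℝ) =>
      {t : ℝ | ENNReal.ofReal t < V x}.indicator (1 : ℝ → ℝ≥0∞) t) :=
    (measurable_const (a := (1 : ℝ≥0∞))).indicator hms
  calc ∫⁻ x, V x ∂μ
      = ∫⁻ x, (∫⁻ t in Ioi (0 : ℝ), {t : ℝ | ENNReal.ofReal t < V x}.indicator 1 t) ∂μ :=
        lintegral_congr fun x => (lintegral_indicator_ofReal_lt (V x)).symm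
    _ = ∫⁻ t in Ioi (0 : ℝ), ∫⁻ x, {t : ℝ | ENNReal.ofReal t < V x}.indicator 1 t ∂μ :=
        lintegral_lintegral_swap hmi.aemeasurable
    _ = _ := lintegral_congr fun t =>
        lintegral_indicator_one (s := V ⁻¹' Ioi (ENNReal.ofReal t)) (hV measurableSet_Ioi)

section WeakConvergence

variable {X : Type*} [TopologicalSpace X] [MeasurableSpace X] [HasOuterApproxClosed X]

lemma lowerSemicontinuous_measure_of_isOpen [OpensMeasurableSpace X] {U : Set X}
    (hU : IsOpen U) : LowerSemicontinuous fun μ : ProbabilityMeasure X => (μ : Measure X) U := by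
  rw [lowerSemicontinuous_iff_le_liminf]
  exact fun μ => ProbabilityMeasure.le_liminf_measure_open_of_tendsto Filter.tendsto_id hU

lemma lowerSemicontinuous_lintegral_measure [BorelSpace X]
    [FirstCountableTopology (ProbabilityMeasure X)] {V : X → ℝ≥0∞} (hV : LowerSemicontinuous V) :
    LowerSemicontinuous fun μ : ProbabilityMeasure X => ∫⁻ x, V x ∂(μ : Measure X) := by
  simp_rw [lintegral_eq_lintegral_measure_ofReal_lt hV.measurable]
  refine lowerSemicontinuous_lintegral (fun μ => ?_) fun t =>
    lowerSemicontinuous_measure_of_isOpen (hV.isOpen_preimage _)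
  refine Antitone.measurable fun s t hst => measure_mono fun x hx => ?_
  exact lt_of_le_of_lt (ENNReal.ofReal_le_ofReal hst) hx

end WeakConvergence

lemma lowerSemicontinuous_intervalEnergy :
    LowerSemicontinuous fun μ : ProbabilityMeasure ℝ => intervalEnergy μ :=
  lowerSemicontinuous_lintegral (fun μ => (measurable_measure_interval (μ : Measure ℝ)).pow_const 2)
    fun _ => (ENNReal.continuous_pow 2).comp_lowerSemicontinuous
      (lowerSemicontinuous_measure_of_isOpen isOpen_Ioo) fun _ _ h => pow_le_pow_left' h 2

/-! ### The constraint -/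

lemma measure_Iio_zero {h : ℝ} {μ : Measure ℝ} (hμ : μ (Icc 0 h)ᶜ = 0) : μ (Iio 0) = 0 :=
  measure_mono_null (fun x (hx : x < 0) (hx' : x ∈ Icc 0 h) => hx.not_ge hx'.1) hμ

lemma withDensity_rnDeriv_restrict_Ioi {μ : Measure ℝ} (hμ : μ (Iio 0) = 0) :
    (volume.restrict (Ioi 0)).withDensity (μ.rnDeriv volume) =
      volume.withDensity (μ.rnDeriv volume) := by
  have hIio : volume.withDensity (μ.rnDeriv volume) (Iio 0) = 0 :=
    le_antisymm ((Measure.withDensity_rnDeriv_le μ volume _).trans hμ.le) zero_le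
  have hzero : volume.withDensity (μ.rnDeriv volume) {0} = 0 :=
    withDensity_absolutelyContinuous _ _ Real.volume_singleton
  rw [← restrict_withDensity measurableSet_Ioi, Measure.restrict_eq_self_of_ae_mem]
  change volume.withDensity (μ.rnDeriv volume) (Ioi 0)ᶜ = 0
  rw [compl_Ioi, ← Iio_union_right]
  exact measure_union_null hIio hzero

/-- The measure `dx / (b x)` on `(0, ∞)`, which is the upper constraint in `𝒫ᵇ([0, h])`. -/
noncomputable def logMeasure (b : ℝ) : Measure ℝ :=
  (volume.restrict (Ioi 0)).withDensity fun x => ENNReal.ofReal (1 / (b * x))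

lemma logMeasure_apply (b : ℝ) {s : Set ℝ} (hs : MeasurableSet s) (hs0 : s ⊆ Ioi 0) :
    logMeasure b s = ∫⁻ x in s, ENNReal.ofReal (1 / (b * x)) := by
  rw [logMeasure, withDensity_apply _ hs, Measure.restrict_restrict hs, inter_eq_left.2 hs0]

lemma logMeasure_absolutelyContinuous (b : ℝ) : logMeasure b ≪ volume :=
  (withDensity_absolutelyContinuous _ _).trans Measure.restrict_le_self.absolutelyContinuous

lemma logMeasure_anti {b b' : ℝ} (hb : 0 < b) (hbb' : b ≤ b') : logMeasure b' ≤ logMeasure b := by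
  refine withDensity_mono ?_
  filter_upwards [ae_restrict_mem measurableSet_Ioi] with x hx
  have hx : 0 < x := hx
  gcongr

lemma le_logMeasure_iff {b : ℝ} {μ : Measure ℝ} [SigmaFinite μ] (hμ : μ (Iio 0) = 0) :
    μ ≤ logMeasure b ↔ μ ≪ volume ∧
      ∀ᵐ x ∂volume, 0 < x → μ.rnDeriv volume x ≤ ENNReal.ofReal (1 / (b * x)) := by
  have hiff : (∀ᵐ x ∂volume, 0 < x → μ.rnDeriv volume x ≤ ENNReal.ofReal (1 / (b * x))) ↔
      ∀ᵐ x ∂volume.restrict (Ioi 0), μ.rnDeriv volume x ≤ ENNReal.ofReal (1 / (b * x)) :=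
    (ae_restrict_iff' measurableSet_Ioi).symm
  rw [hiff]
  constructor
  · intro hle
    have hac : μ ≪ volume := hle.absolutelyContinuous.trans (logMeasure_absolutelyContinuous b)
    refine ⟨hac, ae_le_of_forall_setLIntegral_le_of_sigmaFinite (Measure.measurable_rnDeriv _ _)
      fun s hs _ => ?_⟩
    rw [Measure.restrict_restrict hs, Measure.setLIntegral_rnDeriv hac,
      ← logMeasure_apply b (hs.inter measurableSet_Ioi) inter_subset_right]
    exact hle _
  · rintro ⟨hac, hae⟩
    rw [← Measure.withDensity_rnDeriv_eq μ volume hac, ← withDensity_rnDeriv_restrict_Ioi hμ]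
    exact withDensity_mono hae

lemma mem_constrainedMeasures_iff {b h : ℝ} {μ : Measure ℝ} :
    μ ∈ constrainedMeasures b h ↔
      IsProbabilityMeasure μ ∧ μ (Icc 0 h)ᶜ = 0 ∧ (0 < b → μ ≤ logMeasure b) :=
  and_congr_right fun _ => and_congr_right fun hsupp => imp_congr_right fun _ =>
    (le_logMeasure_iff (measure_Iio_zero hsupp)).symm

lemma logMeasure_ne_top_of_isCompact {b : ℝ} (hb : b ≠ 0) {K : Set ℝ} (hK : IsCompact K)
    (hK0 : K ⊆ Ioi 0) : logMeasure b K ≠ ⊤ := by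
  rw [logMeasure_apply b hK.measurableSet hK0]
  refine (IntegrableOn.setLIntegral_lt_top (ContinuousOn.integrableOn_compact hK ?_)).ne
  exact ContinuousOn.div (by fun_prop) (by fun_prop) fun x hx => mul_ne_zero hb (ne_of_gt (hK0 hx))

lemma measure_le_logMeasure_of_isCompact {b : ℝ} (hb : b ≠ 0) {μ : Measure ℝ}
    (hle : ∀ U : Set ℝ, IsOpen U → U ⊆ Ioi 0 → μ U ≤ logMeasure b U) {K : Set ℝ}
    (hK : IsCompact K) (hK0 : K ⊆ Ioi 0) : μ K ≤ logMeasure b K := by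
  obtain ⟨R, hR, hRsub⟩ := hK.exists_cthickening_subset_open isOpen_Ioi hK0
  have hfin : logMeasure b (Metric.thickening R K) ≠ ⊤ :=
    ne_top_of_le_ne_top (logMeasure_ne_top_of_isCompact hb hK.cthickening hRsub)
      (measure_mono (Metric.thickening_subset_cthickening R K))
  refine ge_of_tendsto (tendsto_measure_thickening_of_isClosed ⟨R, hR, hfin⟩ hK.isClosed) ?_
  filter_upwards [Ioc_mem_nhdsGT hR] with r hr
  refine (measure_mono (Metric.self_subset_thickening hr.1 K)).trans
    (hle _ Metric.isOpen_thickening ?_)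
  exact (Metric.thickening_subset_cthickening_of_le hr.2 K).trans hRsub

lemma le_logMeasure_of_isOpen {b : ℝ} (hb : b ≠ 0) {μ : Measure ℝ} [IsFiniteMeasure μ]
    (h0 : μ (Iic 0) = 0) (hle : ∀ U : Set ℝ, IsOpen U → U ⊆ Ioi 0 → μ U ≤ logMeasure b U) :
    μ ≤ logMeasure b := by
  refine Measure.le_iff.2 fun s hs => ?_
  have hnull : μ (s \ Ioi 0) = 0 := measure_mono_null (fun x hx => (not_lt.1 hx.2 : x ≤ 0)) h0
  rw [← measure_inter_add_sdiff s measurableSet_Ioi, hnull, add_zero,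
    (hs.inter measurableSet_Ioi).measure_eq_iSup_isCompact]
  refine iSup₂_le fun K hKs => iSup_le fun hK => ?_
  exact (measure_le_logMeasure_of_isCompact hb hle hK (hKs.trans inter_subset_right)).trans
    (measure_mono (hKs.trans inter_subset_left))

lemma measureMidpoint_mem_constrainedMeasures {b h : ℝ} {μ μ' : Measure ℝ}
    (hμ : μ ∈ constrainedMeasures b h) (hμ' : μ' ∈ constrainedMeasures b h) :
    measureMidpoint μ μ' ∈ constrainedMeasures b h := by
  rw [mem_constrainedMeasures_iff] at hμ hμ' ⊢
  obtain ⟨_, hsupp, hle⟩ := hμ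
  obtain ⟨_, hsupp', hle'⟩ := hμ'
  have hhalf : ∀ c : ℝ≥0∞, 2⁻¹ * (c + c) = c := fun c => by
    rw [← two_mul, ENNReal.inv_mul_cancel_left two_ne_zero ENNReal.ofNat_ne_top]
  refine ⟨⟨?_⟩, ?_, fun hb => Measure.le_iff.2 fun s _ => ?_⟩
  · rw [measureMidpoint_apply, measure_univ, measure_univ, hhalf]
  · rw [measureMidpoint_apply, hsupp, hsupp', add_zero, mul_zero]
  · rw [measureMidpoint_apply, ← hhalf (logMeasure b s)]
    gcongr
    exacts [hle hb, hle' hb]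

/-! ### Images under power maps -/

lemma map_rpow_withDensity {f : ℝ → ℝ≥0∞} {q : ℝ} (hq : 0 < q) :
    ((volume.restrict (Ioi 0)).withDensity f).map (fun x => x ^ (1 / q)) =
      (volume.restrict (Ioi 0)).withDensity
        fun x => ENNReal.ofReal (q * x ^ (q - 1)) * f (x ^ q) := by
  refine Measure.ext fun s hs => ?_
  have hT : Measurable fun x : ℝ => x ^ (1 / q) := by fun_prop
  have himage : (fun x : ℝ => x ^ (1 / q)) ⁻¹' s ∩ Ioi 0 = (fun x : ℝ => x ^ q) '' (s ∩ Ioi 0) := by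
    simp only [one_div]
    ext y
    constructor
    · rintro ⟨hy, hy0⟩
      exact ⟨y ^ q⁻¹, ⟨hy, Real.rpow_pos_of_pos hy0 _⟩, Real.rpow_inv_rpow (le_of_lt hy0) hq.ne'⟩
    · rintro ⟨x, ⟨hx, hx0⟩, rfl⟩
      refine ⟨?_, Real.rpow_pos_of_pos hx0 _⟩
      rwa [mem_preimage, Real.rpow_rpow_inv (le_of_lt hx0) hq.ne']
  have hinj : InjOn (fun x : ℝ => x ^ q) (s ∩ Ioi 0) :=
    (Real.rpow_left_injOn hq.ne').mono (inter_subset_right.trans Ioi_subset_Ici_self)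
  rw [Measure.map_apply hT hs, withDensity_apply _ (hT hs), withDensity_apply _ hs,
    Measure.restrict_restrict (hT hs), Measure.restrict_restrict hs, himage,
    lintegral_image_eq_lintegral_abs_deriv_mul (hs.inter measurableSet_Ioi)
      (fun x hx => (Real.hasDerivAt_rpow_const (Or.inl (ne_of_gt hx.2))).hasDerivWithinAt) hinj]
  refine setLIntegral_congr_fun (hs.inter measurableSet_Ioi) fun x hx => ?_
  rw [abs_of_nonneg (mul_nonneg hq.le (Real.rpow_nonneg (le_of_lt hx.2) _))]

lemma map_rpow_logMeasure {b p : ℝ} (hp : 0 < p) :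
    (logMeasure b).map (fun x => x ^ p) = logMeasure (b * p) := by
  have hmap := map_rpow_withDensity (f := fun x => ENNReal.ofReal (1 / (b * x)))
    (one_div_pos.2 hp)
  rw [one_div_one_div] at hmap
  rw [logMeasure, hmap, logMeasure]
  refine withDensity_congr_ae ?_
  filter_upwards [ae_restrict_mem measurableSet_Ioi] with x hx
  have hx : 0 < x := hx
  rw [← ENNReal.ofReal_mul (by positivity), Real.rpow_sub_one hx.ne']
  congr 1
  field_simp

lemma map_rpow_compl_Icc {h p : ℝ} (hp : 0 < p) {μ : Measure ℝ} (hμ : μ (Icc 0 h)ᶜ = 0) :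
    μ.map (fun x => x ^ p) (Icc 0 (h ^ p))ᶜ = 0 := by
  rw [Measure.map_apply (by fun_prop) measurableSet_Icc.compl]
  have hmaps : MapsTo (fun x : ℝ => x ^ p) (Icc 0 h) (Icc 0 (h ^ p)) := fun x hx =>
    ⟨Real.rpow_nonneg hx.1 p, Real.rpow_le_rpow hx.1 hx.2 hp.le⟩
  exact measure_mono_null (compl_subset_compl.2 hmaps) hμ

lemma map_rpow_mem_constrainedMeasures {b h p : ℝ} (hp : 0 < p) {μ : Measure ℝ}
    (hμ : μ ∈ constrainedMeasures b h) :
    μ.map (fun x => x ^ p) ∈ constrainedMeasures (b * p) (h ^ p) := by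
  rw [mem_constrainedMeasures_iff] at hμ ⊢
  obtain ⟨_, hsupp, hle⟩ := hμ
  refine ⟨Measure.isProbabilityMeasure_map (by fun_prop), map_rpow_compl_Icc hp hsupp,
    fun hb => ?_⟩
  rw [← map_rpow_logMeasure hp]
  exact Measure.map_mono (hle (pos_of_mul_pos_left hb hp.le)) (by fun_prop)

lemma map_rpow_map_rpow_one_div {h p : ℝ} (hp : p ≠ 0) {μ : Measure ℝ}
    (hμ : μ (Icc 0 h)ᶜ = 0) :
    (μ.map (fun x => x ^ p)).map (fun x => x ^ (1 / p)) = μ := by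
  have hinv : (fun x : ℝ => (x ^ p) ^ (1 / p)) =ᵐ[μ] id := by
    have hmem : ∀ᵐ x ∂μ, x ∈ Icc 0 h := hμ
    filter_upwards [hmem] with x hx
    rw [one_div, Real.rpow_rpow_inv hx.1 hp, id]
  rw [Measure.map_map (by fun_prop) (by fun_prop)]
  exact (Measure.map_congr hinv).trans Measure.map_id

lemma map_rpow_mutuallySingular {h p : ℝ} (hp : 0 < p) {μ : Measure ℝ}
    (hμ : μ (Icc 0 h)ᶜ = 0) (hsing : μ ⟂ₘ volume) : μ.map (fun x => x ^ p) ⟂ₘ volume := by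
  obtain ⟨N, hN, hμN, hvolN⟩ := hsing
  have hS : Measurable fun x : ℝ => x ^ (1 / p) := by fun_prop
  have hac : (volume.restrict (Ioi 0)).map (fun x : ℝ => x ^ (1 / p)) ≪ volume := by
    have hmap := map_rpow_withDensity (f := 1) hp
    rw [withDensity_one] at hmap
    rw [hmap]
    exact (withDensity_absolutelyContinuous _ _).trans
      Measure.restrict_le_self.absolutelyContinuous
  have hnull : volume (((fun x : ℝ => x ^ (1 / p)) ⁻¹' Nᶜ) ∩ Ioi 0) = 0 := by
    rw [← Measure.restrict_apply (hS hN.compl), ← Measure.map_apply hS hN.compl]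
    exact hac hvolN
  refine Measure.MutuallySingular.mk (s := (fun x : ℝ => x ^ (1 / p)) ⁻¹' N ∪ Iio 0)
    (t := ((fun x : ℝ => x ^ (1 / p)) ⁻¹' Nᶜ ∩ Ioi 0) ∪ {0}) ?_ ?_ ?_
  · refine measure_union_null ?_ (measure_Iio_zero (map_rpow_compl_Icc hp hμ))
    rwa [← Measure.map_apply hS hN, map_rpow_map_rpow_one_div hp.ne' hμ]
  · exact measure_union_null hnull Real.volume_singleton
  · intro x _
    rcases lt_trichotomy x 0 with hx | hx | hx
    · exact Or.inl (Or.inr hx)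
    · exact Or.inr (Or.inr hx)
    · by_cases hxN : x ^ (1 / p) ∈ N
      exacts [Or.inl (Or.inl hxN), Or.inr (Or.inl ⟨hxN, hx⟩)]

lemma isPowerPushforward_map {ζ h : ℝ} (hζ : 0 < ζ) {ω : Measure ℝ} [SigmaFinite ω]
    (hω : ω (Icc 0 h)ᶜ = 0) : IsPowerPushforward ζ ω (ω.map fun y => y ^ (1 / ζ)) := by
  refine ⟨rfl, ?_⟩
  set g : ℝ → ℝ≥0∞ := fun x => ENNReal.ofReal (ζ * x ^ (ζ - 1)) * ω.rnDeriv volume (x ^ ζ)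
  have hg : Measurable g := by fun_prop
  have hsing : (ω.singularPart volume).map (fun y => y ^ (1 / ζ)) ⟂ₘ volume :=
    map_rpow_mutuallySingular (one_div_pos.2 hζ)
      (Measure.absolutelyContinuous_of_le (Measure.singularPart_le ω volume) hω)
      (Measure.mutuallySingular_singularPart ω volume)
  have hdecomp : ω.map (fun y => y ^ (1 / ζ)) =
      (ω.singularPart volume).map (fun y => y ^ (1 / ζ)) +
        volume.withDensity ((Ioi 0).indicator g) := by
    conv_lhs => rw [← Measure.singularPart_add_rnDeriv ω volume]
    rw [Measure.map_add _ _ (by fun_prop), ← withDensity_rnDeriv_restrict_Ioi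
      (measure_Iio_zero hω), map_rpow_withDensity hζ, withDensity_indicator measurableSet_Ioi]
  filter_upwards [Measure.eq_rnDeriv (hg.indicator measurableSet_Ioi) hsing hdecomp] with x hx hx0
  rw [← hx, indicator_of_mem (show x ∈ Ioi 0 from hx0)]

/-! ### Finiteness of the energy -/

lemma lintegral_measure_interval (μ : Measure ℝ) [SFinite μ] (r : ℝ) :
    ∫⁻ t, μ (Ioo t (t + r)) = ENNReal.ofReal r * μ univ := by
  have hpre : ∀ x : ℝ, (fun t => (t, x)) ⁻¹' {q : ℝ × ℝ | q.2 ∈ Ioo q.1 (q.1 + r)} =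
      Ioo (x - r) x := fun x => by
    ext t
    simp only [mem_preimage, mem_ofPred_eq, mem_Ioo, sub_lt_iff_lt_add, and_comm]
  have hms : MeasurableSet {q : ℝ × ℝ | q.2 ∈ Ioo q.1 (q.1 + r)} :=
    (measurableSet_lt measurable_fst measurable_snd).inter
      (measurableSet_lt measurable_snd (by fun_prop))
  calc ∫⁻ t, μ (Ioo t (t + r))
      = (volume.prod μ) {q : ℝ × ℝ | q.2 ∈ Ioo q.1 (q.1 + r)} := (Measure.prod_apply hms).symm
    _ = ∫⁻ x, volume (Ioo (x - r) x) ∂μ := by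
        simp_rw [Measure.prod_apply_symm hms, hpre]
    _ = ENNReal.ofReal r * μ univ := by
        simp only [Real.volume_Ioo, sub_sub_cancel, lintegral_const]

lemma lintegral_measure_interval_sq_le (μ : Measure ℝ) [SFinite μ] {r : ℝ} {c : ℝ≥0∞}
    (hc : ∀ t, μ (Ioo t (t + r)) ≤ c) :
    ∫⁻ t, μ (Ioo t (t + r)) ^ 2 ≤ c * (ENNReal.ofReal r * μ univ) := by
  rw [← lintegral_measure_interval μ r, ← lintegral_const_mul c]
  · exact lintegral_mono fun t => (sq _).trans_le (mul_le_mul_left (hc t) _)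
  · exact (measurable_measure_interval μ).comp (by fun_prop : Measurable fun t : ℝ => (r, t))

lemma intervalEnergy_ne_top {μ : Measure ℝ} [IsFiniteMeasure μ] {D : ℝ≥0∞} (hD : D ≠ ⊤)
    (hμD : μ ≤ D • volume) : intervalEnergy μ ≠ ⊤ := by
  have hinterval : ∀ r t : ℝ, μ (Ioo t (t + r)) ≤ D * ENNReal.ofReal r := fun r t =>
    (hμD _).trans_eq (by rw [Measure.smul_apply, Real.volume_Ioo, add_sub_cancel_left, smul_eq_mul])
  rw [intervalEnergy, lintegral_kernelMeasure ((measurable_measure_interval μ).pow_const 2)]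
  refine ENNReal.add_ne_top.2 ⟨?_, ?_⟩
  · refine ne_top_of_le_ne_top (ENNReal.mul_ne_top hD (measure_ne_top μ univ)) ?_
    calc ∫⁻ r in Ioc 0 1, ENNReal.ofReal (1 / r ^ 2) * ∫⁻ t, μ (Ioo t (t + r)) ^ 2
        ≤ ∫⁻ _ in Ioc (0 : ℝ) 1, D * μ univ := by
          refine setLIntegral_mono measurable_const fun r hr => ?_
          have hr : 0 < r := hr.1
          have hcancel : ENNReal.ofReal (1 / r ^ 2) * ENNReal.ofReal r * ENNReal.ofReal r = 1 := by
            rw [← ENNReal.ofReal_mul (by positivity), ← ENNReal.ofReal_mul (by positivity),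
              show 1 / r ^ 2 * r * r = 1 by field_simp, ENNReal.ofReal_one]
          calc ENNReal.ofReal (1 / r ^ 2) * ∫⁻ t, μ (Ioo t (t + r)) ^ 2
              ≤ ENNReal.ofReal (1 / r ^ 2) *
                  (D * ENNReal.ofReal r * (ENNReal.ofReal r * μ univ)) := by
                gcongr
                exact lintegral_measure_interval_sq_le μ (hinterval r)
            _ = ENNReal.ofReal (1 / r ^ 2) * ENNReal.ofReal r * ENNReal.ofReal r *
                  (D * μ univ) := by ring
            _ = D * μ univ := by rw [hcancel, one_mul]
      _ = D * μ univ := by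
          rw [setLIntegral_const, Real.volume_Ioc, sub_zero, ENNReal.ofReal_one, mul_one]
  · refine ne_top_of_le_ne_top ?_
      (lintegral_measure_interval_sq_le μ fun t => measure_mono (subset_univ _))
    finiteness

/-! ### Two logarithmic interactions in an external field -/

/-- The energy of `ω` for the interactions `-ln |x ^ ν - y ^ ν|` and `-ln |x - y|` and the external
field `V`. It is the common form of the functionals of the two model problems. -/
noncomputable def fieldEnergy (ν : ℝ) (V : ℝ → ℝ≥0∞) (ω : Measure ℝ) : ℝ≥0∞ :=
  ENNReal.ofReal (1 / 2) * ∫⁻ x, ∫⁻ y, (negLog |x ^ ν - y ^ ν| + negLog |x - y|) ∂ω ∂ω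
    + ∫⁻ x, V x ∂ω

lemma compl_Icc_zero_one_null {h : ℝ} (hh : h ≤ 1) {μ : Measure ℝ} (hμ : μ (Icc 0 h)ᶜ = 0) :
    μ (Icc 0 1)ᶜ = 0 :=
  measure_mono_null (compl_subset_compl.2 (Icc_subset_Icc_right hh)) hμ

lemma map_rpow_compl_Icc_zero_one {p : ℝ} (hp : 0 < p) {μ : Measure ℝ} (hμ : μ (Icc 0 1)ᶜ = 0) :
    μ.map (fun x => x ^ p) (Icc 0 1)ᶜ = 0 := by
  simpa only [Real.one_rpow] using map_rpow_compl_Icc hp hμ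

lemma lintegral_negLog_abs_rpow_sub_rpow {ν : ℝ} (hν : 0 < ν) {μ : Measure ℝ} [SFinite μ]
    (hμ : μ (Icc 0 1)ᶜ = 0) :
    ∫⁻ x, ∫⁻ y, negLog |x ^ ν - y ^ ν| ∂μ ∂μ = intervalEnergy (μ.map fun x => x ^ ν) := by
  have hm : Measurable fun q : ℝ × ℝ => negLog |q.1 - q.2| := by fun_prop
  have hinner : ∀ x : ℝ, ∫⁻ y, negLog |x - y| ∂(μ.map fun y => y ^ ν) =
      ∫⁻ y, negLog |x - y ^ ν| ∂μ := fun x => lintegral_map (by fun_prop) (by fun_prop)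
  rw [← lintegral_negLog_abs_sub (map_rpow_compl_Icc_zero_one hν hμ),
    lintegral_map hm.lintegral_prod_right' (by fun_prop)]
  simp_rw [hinner]

lemma fieldEnergy_eq {ν : ℝ} (hν : 0 < ν) (V : ℝ → ℝ≥0∞) {μ : Measure ℝ} [SFinite μ]
    (hμ : μ (Icc 0 1)ᶜ = 0) :
    fieldEnergy ν V μ = ENNReal.ofReal (1 / 2) *
      (intervalEnergy (μ.map fun x => x ^ ν) + intervalEnergy μ) + ∫⁻ x, V x ∂μ := by
  have hinner : ∀ x : ℝ, ∫⁻ y, (negLog |x ^ ν - y ^ ν| + negLog |x - y|) ∂μ =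
      ∫⁻ y, negLog |x ^ ν - y ^ ν| ∂μ + ∫⁻ y, negLog |x - y| ∂μ := fun x =>
    lintegral_add_left (by fun_prop) _
  have hm : Measurable fun q : ℝ × ℝ => negLog |q.1 ^ ν - q.2 ^ ν| := by fun_prop
  simp_rw [fieldEnergy, hinner]
  rw [lintegral_add_left hm.lintegral_prod_right', lintegral_negLog_abs_rpow_sub_rpow hν hμ,
    lintegral_negLog_abs_sub hμ]

lemma fieldEnergy_ne_top_iff {ν : ℝ} (hν : 0 < ν) {V : ℝ → ℝ≥0∞} {μ : Measure ℝ} [SFinite μ]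
    (hμ : μ (Icc 0 1)ᶜ = 0) :
    fieldEnergy ν V μ ≠ ⊤ ↔ (intervalEnergy (μ.map fun x => x ^ ν) ≠ ⊤ ∧ intervalEnergy μ ≠ ⊤) ∧
      ∫⁻ x, V x ∂μ ≠ ⊤ := by
  have hhalf : ENNReal.ofReal (1 / 2) ≠ 0 := (ENNReal.ofReal_pos.2 (by norm_num)).ne'
  rw [fieldEnergy_eq hν V hμ, ENNReal.add_ne_top, ← ENNReal.add_ne_top (a := intervalEnergy _)]
  refine and_congr_left' ⟨fun h htop => h ?_, ENNReal.mul_ne_top ENNReal.ofReal_ne_top⟩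
  rw [htop, ENNReal.mul_top hhalf]

/-! ### Uniqueness -/

lemma two_mul_fieldEnergy_measureMidpoint_lt {ν : ℝ} (hν : 0 < ν) {V : ℝ → ℝ≥0∞}
    {ω ω' : Measure ℝ} [IsProbabilityMeasure ω] [IsProbabilityMeasure ω']
    (hω : ω (Icc 0 1)ᶜ = 0) (hω' : ω' (Icc 0 1)ᶜ = 0) (hfin : fieldEnergy ν V ω ≠ ⊤)
    (hfin' : fieldEnergy ν V ω' ≠ ⊤) (hne : ω ≠ ω') :
    2 * fieldEnergy ν V (measureMidpoint ω ω') < fieldEnergy ν V ω + fieldEnergy ν V ω' := by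
  obtain ⟨⟨hmap, hself⟩, hV⟩ := (fieldEnergy_ne_top_iff hν hω).1 hfin
  obtain ⟨⟨hmap', hself'⟩, hV'⟩ := (fieldEnergy_ne_top_iff hν hω').1 hfin'
  have hmid : measureMidpoint ω ω' (Icc 0 1)ᶜ = 0 := by
    rw [measureMidpoint_apply, hω, hω', add_zero, mul_zero]
  have : SFinite (measureMidpoint ω ω') := by unfold measureMidpoint; infer_instance
  have hhalf : ENNReal.ofReal (1 / 2) ≠ 0 := (ENNReal.ofReal_pos.2 (by norm_num)).ne'
  have hinteraction : ENNReal.ofReal (1 / 2) *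
        (2 * intervalEnergy ((measureMidpoint ω ω').map fun x => x ^ ν) +
          2 * intervalEnergy (measureMidpoint ω ω')) <
      ENNReal.ofReal (1 / 2) *
        ((intervalEnergy (ω.map fun x => x ^ ν) + intervalEnergy (ω'.map fun x => x ^ ν)) +
          (intervalEnergy ω + intervalEnergy ω')) := by
    rw [map_measureMidpoint (by fun_prop),
      ENNReal.mul_lt_mul_iff_right hhalf ENNReal.ofReal_ne_top]
    exact ENNReal.add_lt_add_of_le_of_lt
      (ne_top_of_le_ne_top (ENNReal.add_ne_top.2 ⟨hmap, hmap'⟩)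
        (two_mul_intervalEnergy_measureMidpoint_le _ _))
      (two_mul_intervalEnergy_measureMidpoint_le _ _)
      (two_mul_intervalEnergy_measureMidpoint_lt hω hω' hself hself' hne)
  rw [fieldEnergy_eq hν V hω, fieldEnergy_eq hν V hω', fieldEnergy_eq hν V hmid]
  calc _ = ENNReal.ofReal (1 / 2) *
        (2 * intervalEnergy ((measureMidpoint ω ω').map fun x => x ^ ν) +
          2 * intervalEnergy (measureMidpoint ω ω')) + (∫⁻ x, V x ∂ω + ∫⁻ x, V x ∂ω') := by
        rw [← two_mul_lintegral_measureMidpoint]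
        ring
    _ < _ := ENNReal.add_lt_add_right (ENNReal.add_ne_top.2 ⟨hV, hV'⟩) hinteraction
    _ = _ := by ring

lemma isUniqueMinimizer_of_forall_le {b h ν : ℝ} (hν : 0 < ν) (hh : h ≤ 1) {V : ℝ → ℝ≥0∞}
    {ω : Measure ℝ} (hω : ω ∈ constrainedMeasures b h) (hfin : fieldEnergy ν V ω ≠ ⊤)
    (hmin : ∀ ω' ∈ constrainedMeasures b h, fieldEnergy ν V ω ≤ fieldEnergy ν V ω') :
    IsUniqueMinimizer (constrainedMeasures b h) (fieldEnergy ν V) ω := by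
  refine ⟨hω, fun ω' hω' hne => lt_of_not_ge fun hle => ?_⟩
  have := hω.1
  have := hω'.1
  have hlt := two_mul_fieldEnergy_measureMidpoint_lt hν (compl_Icc_zero_one_null hh hω.2.1)
    (compl_Icc_zero_one_null hh hω'.2.1) hfin (ne_top_of_le_ne_top hfin hle) hne.symm
  have hmid := measureMidpoint_mem_constrainedMeasures hω hω'
  refine hlt.not_ge ?_
  calc fieldEnergy ν V ω + fieldEnergy ν V ω' ≤ 2 * fieldEnergy ν V ω := by
        rw [two_mul]
        gcongr
    _ ≤ 2 * fieldEnergy ν V (measureMidpoint ω ω') := by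
        gcongr
        exact hmin _ hmid

/-! ### Existence -/

/-- The constraints defining `𝒫ᵇ([0, h])` that survive weak limits; the mass at the origin is not
restricted, since the upper constraint is only imposed on open subsets of `(0, ∞)`. -/
def relaxedConstraint (b h : ℝ) : Set (ProbabilityMeasure ℝ) :=
  {μ | (μ : Measure ℝ) (Icc 0 h)ᶜ = 0 ∧
    (0 < b → ∀ U : Set ℝ, IsOpen U → U ⊆ Ioi 0 → (μ : Measure ℝ) U ≤ logMeasure b U)}

lemma isCompact_relaxedConstraint (b h : ℝ) : IsCompact (relaxedConstraint b h) := by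
  have hcompact : IsCompact {μ : ProbabilityMeasure ℝ | (μ : Measure ℝ) (Icc 0 h)ᶜ = 0} := by
    have htight := isCompact_setOfPred_probabilityMeasure_mass_eq_compl_isCompact_le (E := ℝ)
      (u := fun _ => 0) (K := fun _ => Icc 0 h) tendsto_const_nhds (fun _ => isCompact_Icc)
      (Or.inl inferInstance)
    simpa only [nonpos_iff_eq_zero, forall_const, ProbabilityMeasure.null_iff_toMeasure_null]
      using htight
  have hclosed : IsClosed {μ : ProbabilityMeasure ℝ | 0 < b → ∀ U : Set ℝ, IsOpen U →
      U ⊆ Ioi 0 → (μ : Measure ℝ) U ≤ logMeasure b U} := by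
    simp only [ofPred_forall]
    exact isClosed_iInter fun _ => isClosed_iInter fun U => isClosed_iInter fun hU =>
      isClosed_iInter fun _ =>
        (lowerSemicontinuous_measure_of_isOpen hU).isClosed_preimage (logMeasure b U)
  exact hcompact.inter_right hclosed

lemma mem_relaxedConstraint_of_mem {b h : ℝ} {μ : ProbabilityMeasure ℝ}
    (hμ : (μ : Measure ℝ) ∈ constrainedMeasures b h) : μ ∈ relaxedConstraint b h := by
  rw [mem_constrainedMeasures_iff] at hμ
  exact ⟨hμ.2.1, fun hb U _ _ => hμ.2.2 hb U⟩

lemma measure_singleton_eq_zero_of_lintegral_negLog_ne_top {μ : Measure ℝ}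
    (hμ : ∫⁻ x, ∫⁻ y, negLog |x - y| ∂μ ∂μ ≠ ⊤) (a : ℝ) : μ {a} = 0 := by
  by_contra h0
  have hatom : ∀ f : ℝ → ℝ≥0∞, f a = ⊤ → ∫⁻ x, f x ∂μ = ⊤ := fun f hf => by
    refine eq_top_iff.2 (le_trans ?_ (setLIntegral_le_lintegral {a} f))
    rw [Measure.restrict_singleton, lintegral_smul_measure, lintegral_dirac, hf, smul_eq_mul,
      ENNReal.mul_top h0]
  exact hμ (hatom _ (hatom _ (by rw [sub_self, abs_zero, negLog_zero])))

lemma mem_constrainedMeasures_of_mem_relaxedConstraint {b h ν : ℝ} (hν : 0 < ν) (hh : h ≤ 1)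
    {V : ℝ → ℝ≥0∞} {μ : ProbabilityMeasure ℝ} (hμ : μ ∈ relaxedConstraint b h)
    (hfin : fieldEnergy ν V μ ≠ ⊤) : (μ : Measure ℝ) ∈ constrainedMeasures b h := by
  have hsupp := compl_Icc_zero_one_null hh hμ.1
  have henergy := ((fieldEnergy_ne_top_iff hν hsupp).1 hfin).1.2
  rw [← lintegral_negLog_abs_sub hsupp] at henergy
  have hIic : (μ : Measure ℝ) (Iic 0) = 0 := by
    rw [← Iio_union_right]
    exact measure_union_null (measure_Iio_zero hμ.1)
      (measure_singleton_eq_zero_of_lintegral_negLog_ne_top henergy 0)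
  exact mem_constrainedMeasures_iff.2
    ⟨inferInstance, hμ.1, fun hb => le_logMeasure_of_isOpen hb.ne' hIic (hμ.2 hb)⟩

lemma lowerSemicontinuous_energy {ν : ℝ} (hν : 0 ≤ ν) {V : ℝ → ℝ≥0∞}
    (hV : LowerSemicontinuous V) :
    LowerSemicontinuous fun μ : ProbabilityMeasure ℝ => ENNReal.ofReal (1 / 2) *
      (intervalEnergy ((μ : Measure ℝ).map fun x => x ^ ν) + intervalEnergy (μ : Measure ℝ)) +
        ∫⁻ x, V x ∂(μ : Measure ℝ) := by
  have hmap : LowerSemicontinuous fun μ : ProbabilityMeasure ℝ =>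
      intervalEnergy ((μ : Measure ℝ).map fun x => x ^ ν) :=
    lowerSemicontinuous_intervalEnergy.comp
      (ProbabilityMeasure.continuous_map (Real.continuous_rpow_const hν))
  exact ((ENNReal.continuous_const_mul ENNReal.ofReal_ne_top).comp_lowerSemicontinuous
    (hmap.add lowerSemicontinuous_intervalEnergy) fun _ _ h => mul_le_mul_right h _).add
      (lowerSemicontinuous_lintegral_measure hV)

lemma logMeasure_restrict_Ioi_le {b δ : ℝ} (hb : 0 < b) (hδ : 0 < δ) :
    (logMeasure b).restrict (Ioi δ) ≤ ENNReal.ofReal (1 / (b * δ)) • volume := by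
  rw [logMeasure, restrict_withDensity measurableSet_Ioi]
  calc _ ≤ ((volume.restrict (Ioi 0)).restrict (Ioi δ)).withDensity
          fun _ => ENNReal.ofReal (1 / (b * δ)) := by
        refine withDensity_mono ((ae_restrict_mem measurableSet_Ioi).mono fun x hx => ?_)
        have hx : δ < x := hx
        change ENNReal.ofReal (1 / (b * x)) ≤ ENNReal.ofReal (1 / (b * δ))
        gcongr
    _ ≤ _ := by
        rw [withDensity_const]
        refine Measure.le_iff'.2 fun s => mul_le_mul_right ?_ _
        exact (Measure.restrict_le_self.trans Measure.restrict_le_self) s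

lemma logMeasure_Ioc {b c d : ℝ} (hb : 0 < b) (hc : 0 < c) (hcd : c ≤ d) :
    logMeasure b (Ioc c d) = ENNReal.ofReal (Real.log (d / c) / b) := by
  have hcont : ContinuousOn (fun x : ℝ => 1 / (b * x)) (uIcc c d) := by
    refine ContinuousOn.div (by fun_prop) (by fun_prop) fun x hx => ?_
    rw [uIcc_of_le hcd] at hx
    have hx := hc.trans_le hx.1
    positivity
  have hnonneg : 0 ≤ᵐ[volume.restrict (Ioc c d)] fun x => 1 / (b * x) := by
    filter_upwards [ae_restrict_mem measurableSet_Ioc] with x hx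
    have hx := hc.trans hx.1
    exact one_div_nonneg.2 (by positivity)
  rw [logMeasure_apply b measurableSet_Ioc fun x hx => hc.trans hx.1,
    ← ofReal_integral_eq_lintegral_ofReal
      ((intervalIntegrable_iff_integrableOn_Ioc_of_le hcd).1 hcont.intervalIntegrable) hnonneg,
    ← intervalIntegral.integral_of_le hcd]
  simp_rw [one_div, mul_inv]
  rw [intervalIntegral.integral_const_mul, integral_inv_of_pos hc (hc.trans_le hcd), inv_mul_eq_div]

lemma restrict_Ioc_compl_Icc (μ : Measure ℝ) {c d e : ℝ} (hc : 0 ≤ c) (hde : d ≤ e) :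
    μ.restrict (Ioc c d) (Icc 0 e)ᶜ = 0 := by
  have hmem : ∀ᵐ x ∂μ.restrict (Ioc c d), x ∈ Icc 0 e :=
    (ae_restrict_mem measurableSet_Ioc).mono fun x hx => ⟨hc.trans hx.1.le, hx.2.trans hde⟩
  exact hmem

lemma fieldEnergy_logMeasure_restrict_ne_top {b c d ν : ℝ} (hb : 0 < b) (hν : 0 < ν) (hc : 0 < c)
    (hcd : c ≤ d) (hd : d ≤ 1) {V : ℝ → ℝ≥0∞} {M : ℝ≥0∞} (hM : M ≠ ⊤)
    (hVM : ∀ x ∈ Ioc c d, V x ≤ M) :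
    fieldEnergy ν V ((logMeasure b).restrict (Ioc c d)) ≠ ⊤ := by
  set ω := (logMeasure b).restrict (Ioc c d)
  have hfinite : IsFiniteMeasure ω :=
    ⟨by rw [Measure.restrict_apply_univ, logMeasure_Ioc hb hc hcd]; exact ENNReal.ofReal_lt_top⟩
  have hsupp : ω (Icc 0 1)ᶜ = 0 := restrict_Ioc_compl_Icc _ hc.le hd
  have hle : ω ≤ ENNReal.ofReal (1 / (b * c)) • volume :=
    (Measure.restrict_mono_set _ Ioc_subset_Ioi_self).trans (logMeasure_restrict_Ioi_le hb hc)
  have hmaple : (ω.map fun x => x ^ ν) ≤ ENNReal.ofReal (1 / (b * ν * c ^ ν)) • volume := by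
    refine le_trans (Measure.le_iff.2 fun s hs => ?_)
      (logMeasure_restrict_Ioi_le (mul_pos hb hν) (Real.rpow_pos_of_pos hc ν))
    have hT : Measurable fun x : ℝ => x ^ ν := by fun_prop
    rw [Measure.map_apply hT hs, Measure.restrict_apply (hT hs), Measure.restrict_apply hs,
      ← map_rpow_logMeasure hν, Measure.map_apply hT (hs.inter measurableSet_Ioi)]
    exact measure_mono fun x hx => ⟨hx.1, Real.rpow_lt_rpow hc.le hx.2.1 hν⟩
  refine (fieldEnergy_ne_top_iff hν hsupp).2 ⟨⟨intervalEnergy_ne_top ENNReal.ofReal_ne_top hmaple,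
    intervalEnergy_ne_top ENNReal.ofReal_ne_top hle⟩, ?_⟩
  refine ne_top_of_le_ne_top (ENNReal.mul_ne_top hM (measure_ne_top ω univ)) ?_
  rw [← lintegral_const]
  exact lintegral_mono_ae ((ae_restrict_mem measurableSet_Ioc).mono hVM)

lemma exists_mem_constrainedMeasures_fieldEnergy_ne_top (b : ℝ) {h ν : ℝ} (hν : 0 < ν)
    (hh : 0 < h) (hh1 : h ≤ 1) {V : ℝ → ℝ≥0∞}
    (hbdd : ∀ a > 0, ∃ M : ℝ≥0∞, M ≠ ⊤ ∧ ∀ x ∈ Ioc a (h / 2), V x ≤ M) :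
    ∃ ω ∈ constrainedMeasures b h, fieldEnergy ν V ω ≠ ⊤ := by
  set B : ℝ := max b 1
  have hB : 0 < B := lt_max_of_lt_right one_pos
  -- the left end point for which `dx / (B x)` has mass `1` on `(a, h / 2]`
  set a : ℝ := h / 2 * Real.exp (-B) with ha
  have ha0 : 0 < a := by positivity
  have hah : a ≤ h / 2 :=
    mul_le_of_le_one_right (by positivity) (Real.exp_le_one_iff.2 (neg_nonpos.2 hB.le))
  obtain ⟨M, hM, hVM⟩ := hbdd a ha0
  refine ⟨(logMeasure B).restrict (Ioc a (h / 2)), mem_constrainedMeasures_iff.2 ⟨⟨?_⟩, ?_, ?_⟩,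
    fieldEnergy_logMeasure_restrict_ne_top hB hν ha0 hah (by linarith) hM hVM⟩
  · rw [Measure.restrict_apply_univ, logMeasure_Ioc hB ha0 hah, ha,
      div_mul_cancel_left₀ (by positivity), ← Real.exp_neg, neg_neg, Real.log_exp,
      div_self hB.ne', ENNReal.ofReal_one]
  · exact restrict_Ioc_compl_Icc _ ha0.le (half_le_self hh.le)
  · exact fun hb => Measure.restrict_le_self.trans (logMeasure_anti hb (le_max_left b 1))

lemma exists_isUniqueMinimizer (b : ℝ) {h ν : ℝ} (hν : 0 < ν) (hh : 0 < h) (hh1 : h ≤ 1)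
    {V : ℝ → ℝ≥0∞} (hV : LowerSemicontinuous V)
    (hbdd : ∀ a > 0, ∃ M : ℝ≥0∞, M ≠ ⊤ ∧ ∀ x ∈ Ioc a (h / 2), V x ≤ M) :
    ∃ ω, IsUniqueMinimizer (constrainedMeasures b h) (fieldEnergy ν V) ω := by
  obtain ⟨ω₀, hω₀, hfin₀⟩ := exists_mem_constrainedMeasures_fieldEnergy_ne_top b hν hh hh1 hbdd
  have hmem : ∀ ω, ∀ hω : ω ∈ constrainedMeasures b h,
      (⟨ω, hω.1⟩ : ProbabilityMeasure ℝ) ∈ relaxedConstraint b h := fun ω hω =>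
    mem_relaxedConstraint_of_mem hω
  obtain ⟨μ, hμ, hmin⟩ := LowerSemicontinuousOn.exists_isMinOn (s := relaxedConstraint b h)
    ⟨_, hmem ω₀ hω₀⟩ (isCompact_relaxedConstraint b h)
    ((lowerSemicontinuous_energy hν.le hV).lowerSemicontinuousOn _)
  have hle : ∀ ω ∈ constrainedMeasures b h, fieldEnergy ν V μ ≤ fieldEnergy ν V ω := by
    intro ω hω
    have := hω.1
    rw [fieldEnergy_eq hν V (compl_Icc_zero_one_null hh1 hμ.1),
      fieldEnergy_eq hν V (compl_Icc_zero_one_null hh1 hω.2.1)]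
    exact hmin (hmem ω hω)
  have hfin : fieldEnergy ν V μ ≠ ⊤ := ne_top_of_le_ne_top hfin₀ (hle ω₀ hω₀)
  exact ⟨μ, isUniqueMinimizer_of_forall_le hν hh1
    (mem_constrainedMeasures_of_mem_relaxedConstraint hν hh1 hμ hfin) hfin hle⟩

/-! ### Existence and uniqueness for the model problems -/

namespace ModelParameters

/-- The external field of a model problem; the exponent `σ` is `ν` in the first problem and `1` in
the second. -/
noncomputable def externalField (p : ModelParameters) (σ β x : ℝ) : ℝ≥0∞ :=
  ENNReal.ofReal (1 / p.κ) *
      (∫⁻ u in Ioc p.n₁ p.n₂, negLog (1 - x ^ σ * Real.exp (-(β * p.α * u))))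
    + ENNReal.ofReal p.m₁ * negLog x

/-- The common form of the functionals of the two model problems, with `σ = ν` in the first and
`σ = 1` in the second. -/
noncomputable def functional (p : ModelParameters) (σ β : ℝ) (ω : Measure ℝ) : ℝ≥0∞ :=
  fieldEnergy p.ν (p.externalField σ β) ω

lemma lintegral_externalField (p : ModelParameters) (σ β : ℝ) (ω : Measure ℝ) :
    ∫⁻ x, p.externalField σ β x ∂ω =
      ENNReal.ofReal (1 / p.κ) * ∫⁻ x, (∫⁻ u in Ioc p.n₁ p.n₂,
          negLog (1 - x ^ σ * Real.exp (-(β * p.α * u)))) ∂ω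
        + ENNReal.ofReal p.m₁ * ∫⁻ x, negLog x ∂ω := by
  simp only [externalField]
  rw [lintegral_add_right _ (by fun_prop), lintegral_const_mul' _ _ ENNReal.ofReal_ne_top,
    lintegral_const_mul' _ _ ENNReal.ofReal_ne_top]

lemma firstFunctional_eq (p : ModelParameters) (β : ℝ) {ω : Measure ℝ} (hω : ω (Icc 0 1)ᶜ = 0) :
    p.firstFunctional β ω = p.functional p.ν β ω := by
  simp only [firstFunctional, functional, fieldEnergy, lintegral_externalField, add_assoc,
    Measure.restrict_eq_self_of_ae_mem (show ∀ᵐ x ∂ω, x ∈ Icc 0 1 from hω)]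

lemma secondFunctional_eq (p : ModelParameters) (β : ℝ) {ω : Measure ℝ} (hω : ω (Icc 0 1)ᶜ = 0) :
    p.secondFunctional β ω = p.functional 1 β ω := by
  simp only [secondFunctional, functional, fieldEnergy, lintegral_externalField, add_assoc,
    Real.rpow_one, Measure.restrict_eq_self_of_ae_mem (show ∀ᵐ x ∂ω, x ∈ Icc 0 1 from hω)]

lemma lowerSemicontinuous_externalField (p : ModelParameters) {σ : ℝ} (hσ : 0 ≤ σ) (β : ℝ) :
    LowerSemicontinuous (p.externalField σ β) := by
  have hscale : ∀ (c : ℝ) {f : ℝ → ℝ≥0∞}, LowerSemicontinuous f →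
      LowerSemicontinuous fun x => ENNReal.ofReal c * f x := fun c f hf =>
    (ENNReal.continuous_const_mul ENNReal.ofReal_ne_top).comp_lowerSemicontinuous hf
      fun _ _ h => mul_le_mul_right h _
  refine .add (hscale _ (lowerSemicontinuous_lintegral (fun x => by fun_prop) fun u => ?_))
    (hscale _ lowerSemicontinuous_negLog)
  have hcont : Continuous fun x : ℝ => 1 - x ^ σ * Real.exp (-(β * p.α * u)) :=
    continuous_const.sub ((Real.continuous_rpow_const hσ).mul continuous_const)
  exact lowerSemicontinuous_negLog.comp hcont

lemma exists_externalField_le (p : ModelParameters) {σ β h a : ℝ} (hσ : 0 < σ)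
    (hβ : 0 ≤ β * p.α) (hh : 0 < h) (hend : h ^ σ * Real.exp (-(β * p.α * p.n₁)) ≤ 1)
    (ha : 0 < a) : ∃ M : ℝ≥0∞, M ≠ ⊤ ∧ ∀ x ∈ Ioc a (h / 2), p.externalField σ β x ≤ M := by
  have hlt : (1 / 2 : ℝ) ^ σ < 1 := Real.rpow_lt_one (by norm_num) (by norm_num) hσ
  refine ⟨ENNReal.ofReal (1 / p.κ) * (negLog (1 - (1 / 2) ^ σ) * volume (Ioc p.n₁ p.n₂))
    + ENNReal.ofReal p.m₁ * negLog a, ?_, fun x hx => ?_⟩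
  · rw [negLog_of_pos (by linarith), negLog_of_pos ha, Real.volume_Ioc]
    finiteness
  · have hx0 : 0 < x := ha.trans hx.1
    have hxh : x ≤ h * (1 / 2) := by linarith [hx.2]
    refine add_le_add ?_ (by gcongr; exact antitone_negLog hx.1.le)
    gcongr
    rw [← setLIntegral_const]
    refine setLIntegral_mono measurable_const fun u hu => antitone_negLog (sub_le_sub_left ?_ 1)
    have hu : p.n₁ ≤ u := hu.1.le
    calc x ^ σ * Real.exp (-(β * p.α * u))
        ≤ (h * (1 / 2)) ^ σ * Real.exp (-(β * p.α * p.n₁)) := by gcongr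
      _ = (h ^ σ * Real.exp (-(β * p.α * p.n₁))) * (1 / 2) ^ σ := by
          rw [Real.mul_rpow hh.le (by norm_num), mul_right_comm]
      _ ≤ (1 / 2) ^ σ := mul_le_of_le_one_left (by positivity) hend

lemma exp_competitors_le_one {p : ModelParameters} {γ β : ℝ} (hβ : 0 ≤ β) (hρ : 0 ≤ p.ρ)
    (hκ : p.κ ≤ γ ^ 2) : Real.exp (-(p.ρ * β * (γ ^ 2 - p.κ))) ≤ 1 :=
  Real.exp_le_one_iff.2 (neg_nonpos.2 (mul_nonneg (mul_nonneg hρ hβ) (sub_nonneg.2 hκ)))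

lemma exists_isUniqueMinimizer_functional {p : ModelParameters} {γ β σ : ℝ} (hβ : 0 ≤ β)
    (hσ : 0 < σ) (hν : 0 < p.ν) (hα : 0 ≤ p.α) (hρ : 0 ≤ p.ρ) (hκ : p.κ ≤ γ ^ 2)
    (hend : p.n₁ * p.α = -(σ * p.ρ * (γ ^ 2 - p.κ))) :
    ∃ ω, IsUniqueMinimizer (p.competitors γ β) (p.functional σ β) ω := by
  refine exists_isUniqueMinimizer _ hν (Real.exp_pos _) (exp_competitors_le_one hβ hρ hκ)
    (p.lowerSemicontinuous_externalField hσ.le β) fun a ha =>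
      p.exists_externalField_le hσ (mul_nonneg hβ hα) (Real.exp_pos _) ?_ ha
  rw [← Real.exp_mul, ← Real.exp_add, Real.exp_le_one_iff]
  exact le_of_eq (by linear_combination -β * hend)

end ModelParameters

/-! ### Transfer of minimizers under power maps -/

lemma IsUniqueMinimizer.congr {C : Set (Measure ℝ)} {F G : Measure ℝ → ℝ≥0∞} {μ : Measure ℝ}
    (hμ : IsUniqueMinimizer C F μ) (hFG : ∀ μ ∈ C, G μ = F μ) : IsUniqueMinimizer C G μ :=
  ⟨hμ.1, fun μ' hμ' hne => by
    rw [hFG μ hμ.1, hFG μ' hμ']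
    exact hμ.2 μ' hμ' hne⟩

lemma IsUniqueMinimizer.map_rpow {b h ζ c : ℝ} (hζ : 0 < ζ) (hh : 0 ≤ h) (hc : 0 < c)
    {F G : Measure ℝ → ℝ≥0∞} {ω : Measure ℝ}
    (hω : IsUniqueMinimizer (constrainedMeasures (b * ζ) (h ^ ζ)) G ω)
    (hFG : ∀ μ ∈ constrainedMeasures b h, F μ = ENNReal.ofReal c * G (μ.map fun x => x ^ ζ)) :
    IsUniqueMinimizer (constrainedMeasures b h) F (ω.map fun y => y ^ (1 / ζ)) := by
  have hmem : ω.map (fun y => y ^ (1 / ζ)) ∈ constrainedMeasures b h := by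
    have hmap := map_rpow_mem_constrainedMeasures (one_div_pos.2 hζ) hω.1
    rwa [mul_assoc, mul_one_div_cancel hζ.ne', mul_one, one_div ζ, Real.rpow_rpow_inv hh hζ.ne',
      ← one_div] at hmap
  have hinv : (ω.map fun y => y ^ (1 / ζ)).map (fun x => x ^ ζ) = ω := by
    simpa only [one_div_one_div] using
      map_rpow_map_rpow_one_div (one_div_ne_zero hζ.ne') hω.1.2.1
  refine ⟨hmem, fun μ hμ hne => ?_⟩
  rw [hFG _ hmem, hFG _ hμ, hinv]
  refine ENNReal.mul_lt_mul_right (by simpa using hc) ENNReal.ofReal_ne_top ?_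
  refine hω.2 _ (map_rpow_mem_constrainedMeasures hζ hμ) fun heq => hne ?_
  rw [← map_rpow_map_rpow_one_div hζ.ne' hμ.2.1, heq]

namespace ModelParameters

/-- The functional of a model problem, pulled back along `x ↦ x ^ ρ` and multiplied by `κ²`. This is
the shape of the rate functions. -/
noncomputable def pullbackFunctional (p : ModelParameters) (σ β : ℝ) (μ : Measure ℝ) : ℝ≥0∞ :=
  ENNReal.ofReal (p.κ ^ 2 / 2) *
      ∫⁻ x, ∫⁻ y, (negLog |x ^ (p.ρ * p.ν) - y ^ (p.ρ * p.ν)| + negLog |x ^ p.ρ - y ^ p.ρ|) ∂μ ∂μ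
    + ENNReal.ofReal p.κ * ∫⁻ x, (∫⁻ u in Ioc p.n₁ p.n₂,
        negLog (1 - x ^ (p.ρ * σ) * Real.exp (-(β * p.α * u)))) ∂μ
    + ENNReal.ofReal (p.κ ^ 2 * p.m₁ * p.ρ) * ∫⁻ x, negLog x ∂μ

lemma functional_map_rpow (p : ModelParameters) (hρ : 0 < p.ρ) (σ β : ℝ) {μ : Measure ℝ}
    [SFinite μ] (hμ : μ (Icc 0 1)ᶜ = 0) :
    p.functional σ β (μ.map fun x => x ^ p.ρ) =
      ENNReal.ofReal (1 / 2) * ∫⁻ x, ∫⁻ y,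
          (negLog |x ^ (p.ρ * p.ν) - y ^ (p.ρ * p.ν)| + negLog |x ^ p.ρ - y ^ p.ρ|) ∂μ ∂μ
      + (ENNReal.ofReal (1 / p.κ) * ∫⁻ x, (∫⁻ u in Ioc p.n₁ p.n₂,
            negLog (1 - x ^ (p.ρ * σ) * Real.exp (-(β * p.α * u)))) ∂μ
        + ENNReal.ofReal p.m₁ * (ENNReal.ofReal p.ρ * ∫⁻ x, negLog x ∂μ)) := by
  have hT : Measurable fun x : ℝ => x ^ p.ρ := by fun_prop
  have hae : ∀ᵐ x ∂μ, x ∈ Icc (0 : ℝ) 1 := hμ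
  have hinteraction : Measurable fun q : ℝ × ℝ =>
      negLog |q.1 ^ p.ν - q.2 ^ p.ν| + negLog |q.1 - q.2| := by fun_prop
  have hfield : Measurable fun q : ℝ × ℝ =>
      negLog (1 - q.1 ^ σ * Real.exp (-(β * p.α * q.2))) := by fun_prop
  rw [functional, fieldEnergy, lintegral_externalField,
    lintegral_map hinteraction.lintegral_prod_right' hT,
    lintegral_map hfield.lintegral_prod_right' hT, lintegral_map measurable_negLog hT,
    ← lintegral_const_mul' (ENNReal.ofReal p.ρ) _ ENNReal.ofReal_ne_top]
  congr 2
  · refine lintegral_congr_ae ?_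
    filter_upwards [hae] with x hx
    rw [lintegral_map (by fun_prop) hT]
    refine lintegral_congr_ae ?_
    filter_upwards [hae] with y hy
    rw [Real.rpow_mul hx.1, Real.rpow_mul hy.1]
  · congr 1
    refine lintegral_congr_ae ?_
    filter_upwards [hae] with x hx
    rw [Real.rpow_mul hx.1]
  · congr 1
    refine lintegral_congr_ae ?_
    filter_upwards [hae] with x hx using negLog_rpow hx.1 hρ

lemma pullbackFunctional_eq {p : ModelParameters} (hκ : 0 < p.κ) (hm : 0 ≤ p.m₁) (hρ : 0 < p.ρ)
    (σ β : ℝ) {μ : Measure ℝ} [SFinite μ] (hμ : μ (Icc 0 1)ᶜ = 0) :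
    p.pullbackFunctional σ β μ =
      ENNReal.ofReal (p.κ ^ 2) * p.functional σ β (μ.map fun x => x ^ p.ρ) := by
  have hscale : p.κ ^ 2 * (1 / p.κ) = p.κ := by field_simp
  rw [p.functional_map_rpow hρ σ β hμ, pullbackFunctional, div_eq_mul_one_div (p.κ ^ 2) 2]
  nth_rw 2 [← hscale]
  rw [ENNReal.ofReal_mul (by positivity), ENNReal.ofReal_mul (by positivity),
    ENNReal.ofReal_mul (by positivity), ENNReal.ofReal_mul (by positivity)]
  ring

lemma isUniqueMinimizer_pullbackFunctional {p : ModelParameters} {γ β σ : ℝ} {ω : Measure ℝ}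
    (hβ : 0 ≤ β) (hκ : 0 < p.κ) (hm : 0 ≤ p.m₁) (hρ : 0 < p.ρ) (hκγ : p.κ ≤ γ ^ 2)
    (hω : IsUniqueMinimizer (p.competitors γ β) (p.functional σ β) ω) :
    IsUniqueMinimizer (constrainedMeasures (β * p.κ) (Real.exp (-(β * (γ ^ 2 - p.κ)))))
      (p.pullbackFunctional σ β) (ω.map fun y => y ^ (1 / p.ρ)) := by
  have hexp : Real.exp (-(p.ρ * β * (γ ^ 2 - p.κ))) =
      Real.exp (-(β * (γ ^ 2 - p.κ))) ^ p.ρ := by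
    rw [← Real.exp_mul]
    ring_nf
  have hle : Real.exp (-(β * (γ ^ 2 - p.κ))) ≤ 1 :=
    Real.exp_le_one_iff.2 (neg_nonpos.2 (mul_nonneg hβ (sub_nonneg.2 hκγ)))
  rw [competitors, hexp, mul_right_comm] at hω
  refine hω.map_rpow hρ (Real.exp_pos _).le (pow_pos hκ 2) fun μ hμ => ?_
  have := hμ.1
  exact pullbackFunctional_eq hκ hm hρ σ β (compl_Icc_zero_one_null hle hμ.2.1)

end ModelParameters

lemma recoveredFromFirst {γ η θ β ξ : ℝ} (hβ : 0 ≤ β) {p : ModelParameters}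
    (hp : p.FirstAdmissible γ) (hκ : kappa γ ξ = p.κ) (hκγ : p.κ ≤ γ ^ 2)
    (hrate : rateFunction γ η θ β ξ = p.pullbackFunctional p.ν β) :
    RecoveredFromFirst γ η θ β ξ p.ρ p := by
  obtain ⟨⟨hν, hκ0, hα, hρ, hm, -⟩, hend⟩ := id hp
  have hν0 : 0 < p.ν := one_pos.trans hν
  obtain ⟨ω, hω⟩ := ModelParameters.exists_isUniqueMinimizer_functional hβ hν0 hν0 hα.le hρ.le
    hκγ hend
  have := hω.1.1
  refine ⟨hp, ω, _, hω.congr fun ω' hω' => p.firstFunctional_eq β (compl_Icc_zero_one_null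
    (ModelParameters.exp_competitors_le_one hβ hρ.le hκγ) hω'.2.1), ?_,
    isPowerPushforward_map hρ hω.1.2.1⟩
  rw [IsEquilibriumMeasure, sliceMeasures, hκ, hrate]
  exact ModelParameters.isUniqueMinimizer_pullbackFunctional hβ hκ0 hm hρ hκγ hω

lemma recoveredFromSecond {γ η θ β ξ : ℝ} (hβ : 0 ≤ β) {p : ModelParameters}
    (hp : p.SecondAdmissible γ) (hκ : kappa γ ξ = p.κ) (hκγ : p.κ ≤ γ ^ 2)
    (hrate : rateFunction γ η θ β ξ = p.pullbackFunctional 1 β) :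
    RecoveredFromSecond γ η θ β ξ p.ρ p := by
  obtain ⟨⟨hν, hκ0, hα, hρ, hm, -⟩, hend⟩ := id hp
  obtain ⟨ω, hω⟩ := ModelParameters.exists_isUniqueMinimizer_functional hβ one_pos
    (one_pos.trans hν) hα.le hρ.le hκγ (by rwa [one_mul])
  have := hω.1.1
  refine ⟨hp, ω, _, hω.congr fun ω' hω' => p.secondFunctional_eq β (compl_Icc_zero_one_null
    (ModelParameters.exp_competitors_le_one hβ hρ.le hκγ) hω'.2.1), ?_,
    isPowerPushforward_map hρ hω.1.2.1⟩
  rw [IsEquilibriumMeasure, sliceMeasures, hκ, hrate]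
  exact ModelParameters.isUniqueMinimizer_pullbackFunctional hβ hκ0 hm hρ hκγ hω

/-! ### The parameters of the slice at time `ξ` -/

lemma kappa_of_nonpos {γ ξ : ℝ} (hξ : ξ ≤ 0) : kappa γ ξ = γ ^ 2 - |ξ| := if_pos hξ

lemma kappa_of_pos_of_le {γ ξ : ℝ} (hξ : 0 < ξ) (hξγ : ξ ≤ 1 - γ ^ 2) : kappa γ ξ = γ ^ 2 := by
  rw [kappa, if_neg hξ.not_ge, if_pos hξγ]

lemma kappa_of_pos_of_lt {γ ξ : ℝ} (hξ : 0 < ξ) (hξγ : 1 - γ ^ 2 < ξ) : kappa γ ξ = 1 - ξ := by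
  rw [kappa, if_neg hξ.not_ge, if_neg hξγ.not_ge]

lemma kappa_pos {γ ξ : ℝ} (hγ : γ ≠ 0) (hξ : ξ ∈ Ioo (-γ ^ 2) 1) : 0 < kappa γ ξ := by
  have := hξ.1
  have := hξ.2
  unfold kappa
  split_ifs with h0
  · rw [abs_of_nonpos h0]
    linarith
  · positivity
  · linarith

lemma kappa_le (γ ξ : ℝ) : kappa γ ξ ≤ γ ^ 2 := by
  unfold kappa
  split_ifs
  · exact sub_le_self _ (abs_nonneg ξ)
  · exact le_rfl
  · linarith

/-- The exponent of `x` in the Pochhammer weights of the slice at time `ξ`. -/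
noncomputable def pochhammerExponent (γ η θ ξ : ℝ) : ℝ :=
  if ξ ≤ 1 - γ ^ 2 then θ else η

/-- The upper end point of the range of `u` in the Pochhammer weights of the slice at time `ξ`,
after the substitution `u ↦ -u` in the range `ξ ≤ 0`. The lower end point is then
`kappa γ ξ - γ ^ 2`. -/
noncomputable def pochhammerUpper (γ ξ : ℝ) : ℝ :=
  if ξ ≤ 0 then 1 - γ ^ 2 else if ξ ≤ 1 - γ ^ 2 then 1 - γ ^ 2 - ξ else 0

/-- The factor of `κ ∫ ln x dμ(x)` in the rate function of the slice at time `ξ`. -/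
noncomputable def logCharge (η θ ξ : ℝ) : ℝ :=
  if ξ ≤ 0 then η * |ξ| else θ * ξ

/-- The parameters of the model problem from which the equilibrium measure of the slice at time `ξ`
is recovered. -/
noncomputable def sliceParameters (γ η θ ξ : ℝ) : ModelParameters where
  ν := max η θ / min η θ
  κ := kappa γ ξ
  m₁ := logCharge η θ ξ / (kappa γ ξ * min η θ)
  n₁ := kappa γ ξ - γ ^ 2
  n₂ := pochhammerUpper γ ξ
  α := pochhammerExponent γ η θ ξ
  ρ := min η θ

lemma sliceParameters_of_nonpos {γ η θ ξ : ℝ} (hγ : γ ^ 2 ≤ 1) (hξ : ξ ≤ 0) :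
    sliceParameters γ η θ ξ =
      { ν := max η θ / min η θ, κ := γ ^ 2 - |ξ|, m₁ := η * |ξ| / ((γ ^ 2 - |ξ|) * min η θ),
        n₁ := -|ξ|, n₂ := 1 - γ ^ 2, α := θ, ρ := min η θ } := by
  simp only [sliceParameters, logCharge, pochhammerUpper, pochhammerExponent, kappa_of_nonpos hξ,
    if_pos hξ, if_pos (hξ.trans (sub_nonneg.2 hγ)), sub_sub_cancel_left]

lemma sliceParameters_of_pos_of_le {γ η θ ξ : ℝ} (hξ : 0 < ξ) (hξγ : ξ ≤ 1 - γ ^ 2) :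
    sliceParameters γ η θ ξ =
      { ν := max η θ / min η θ, κ := γ ^ 2, m₁ := θ * ξ / (γ ^ 2 * min η θ),
        n₁ := 0, n₂ := 1 - γ ^ 2 - ξ, α := θ, ρ := min η θ } := by
  simp only [sliceParameters, logCharge, pochhammerUpper, pochhammerExponent,
    kappa_of_pos_of_le hξ hξγ, if_neg hξ.not_ge, if_pos hξγ, sub_self]

lemma sliceParameters_of_pos_of_lt {γ η θ ξ : ℝ} (hξ : 0 < ξ) (hξγ : 1 - γ ^ 2 < ξ) :
    sliceParameters γ η θ ξ =
      { ν := max η θ / min η θ, κ := 1 - ξ, m₁ := θ * ξ / ((1 - ξ) * min η θ),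
        n₁ := 1 - γ ^ 2 - ξ, n₂ := 0, α := η, ρ := min η θ } := by
  simp only [sliceParameters, logCharge, pochhammerUpper, pochhammerExponent,
    kappa_of_pos_of_lt hξ hξγ, if_neg hξ.not_ge, if_neg hξγ.not_ge, sub_right_comm]

lemma sliceParameters_standing {γ η θ ξ : ℝ} (hγ : γ ≠ 0) (hγ1 : γ ^ 2 ≤ 1) (hη : 0 < η)
    (hθ : 0 < θ) (hηθ : η ≠ θ) (hξ : ξ ∈ Ioo (-γ ^ 2) 1) :
    (sliceParameters γ η θ ξ).Standing := by
  have hmin : 0 < min η θ := lt_min hη hθ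
  have hκ : 0 < kappa γ ξ := kappa_pos hγ hξ
  refine ⟨(one_lt_div hmin).2 (min_lt_max.2 hηθ), hκ, ?_, hmin, ?_, ?_⟩
  · simp only [sliceParameters, pochhammerExponent]
    split_ifs <;> assumption
  · have hcharge : 0 ≤ logCharge η θ ξ := by
      unfold logCharge
      split_ifs with h0
      · positivity
      · exact mul_nonneg hθ.le (not_le.1 h0).le
    exact div_nonneg hcharge (by positivity)
  · simp only [sliceParameters, pochhammerUpper]
    have := kappa_le γ ξ
    split_ifs <;> linarith

lemma setLIntegral_Ioc_comp_neg (a b : ℝ) (f : ℝ → ℝ≥0∞) :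
    ∫⁻ u in Ioc a b, f u = ∫⁻ u in Ioc (-b) (-a), f (-u) := by
  rw [← (Measure.measurePreserving_neg (volume : Measure ℝ)).setLIntegral_comp_preimage_emb
    (Homeomorph.neg ℝ).measurableEmbedding f (Ioc a b)]
  simp only [neg_preimage, neg_Ioc]
  exact setLIntegral_congr Ico_ae_eq_Ioc

lemma interactionEnergy_eq (γ η θ ξ : ℝ) (μ : Measure ℝ) :
    interactionEnergy γ η θ ξ μ = ENNReal.ofReal (kappa γ ξ ^ 2 / 2) * ∫⁻ x, ∫⁻ y,
      (negLog |x ^ max η θ - y ^ max η θ| + negLog |x ^ min η θ - y ^ min η θ|) ∂μ ∂μ := by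
  rcases le_total η θ with h | h
  · rw [interactionEnergy, max_eq_right h, min_eq_left h]
  · simp only [interactionEnergy, max_eq_left h, min_eq_right h, add_comm]

lemma pochhammerEnergy_eq {γ : ℝ} (hγ : γ ^ 2 ≤ 1) (η θ β ξ : ℝ) (μ : Measure ℝ) :
    pochhammerEnergy γ η θ β ξ μ = ENNReal.ofReal (kappa γ ξ) * ∫⁻ x,
      (∫⁻ u in Ioc (kappa γ ξ - γ ^ 2) (pochhammerUpper γ ξ),
        negLog (1 - x ^ pochhammerExponent γ η θ ξ *
          Real.exp (-(β * pochhammerExponent γ η θ ξ * u)))) ∂μ := by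
  rcases le_or_gt ξ 0 with h0 | h0
  · simp only [pochhammerEnergy, pochhammerUpper, pochhammerExponent, kappa_of_nonpos h0, if_pos h0,
      if_pos (h0.trans (sub_nonneg.2 hγ)), setLIntegral_Ioc_comp_neg (γ ^ 2 - 1) |ξ|, neg_sub,
      mul_neg, sub_sub_cancel_left]
  rcases le_or_gt ξ (1 - γ ^ 2) with hγξ | hγξ
  · simp only [pochhammerEnergy, pochhammerUpper, pochhammerExponent, kappa_of_pos_of_le h0 hγξ,
      if_neg h0.not_ge, if_pos hγξ, sub_self]
  · simp only [pochhammerEnergy, pochhammerUpper, pochhammerExponent, kappa_of_pos_of_lt h0 hγξ,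
      if_neg h0.not_ge, if_neg hγξ.not_ge, sub_right_comm]

lemma rateFunction_eq {γ η θ ξ σ : ℝ} (hγ : γ ^ 2 ≤ 1) (hκ : kappa γ ξ ≠ 0) (hmin : min η θ ≠ 0)
    (hσ : min η θ * σ = pochhammerExponent γ η θ ξ) (β : ℝ) :
    rateFunction γ η θ β ξ = (sliceParameters γ η θ ξ).pullbackFunctional σ β := by
  have hlog : kappa γ ξ * logCharge η θ ξ =
      kappa γ ξ ^ 2 * (logCharge η θ ξ / (kappa γ ξ * min η θ)) * min η θ := by
    field_simp
  ext μ
  simp only [rateFunction, interactionEnergy_eq, pochhammerEnergy_eq hγ,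
    ModelParameters.pullbackFunctional, sliceParameters, mul_div_cancel₀ _ hmin, hσ]
  rw [logEnergy, ← logCharge, hlog]

lemma recoveredFromFirst_sliceParameters {γ η θ β ξ : ℝ} (hγ : γ ≠ 0) (hγ1 : γ ^ 2 ≤ 1)
    (hη : 0 < η) (hθ : 0 < θ) (hβ : 0 ≤ β) (hηθ : η ≠ θ) (hξ : ξ ∈ Ioo (-γ ^ 2) 1)
    (hmax : pochhammerExponent γ η θ ξ = max η θ) :
    RecoveredFromFirst γ η θ β ξ (min η θ) (sliceParameters γ η θ ξ) := by
  have hmin : min η θ ≠ 0 := (lt_min hη hθ).ne'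
  have hσ : min η θ * (max η θ / min η θ) = max η θ := mul_div_cancel₀ _ hmin
  refine recoveredFromFirst hβ ⟨sliceParameters_standing hγ hγ1 hη hθ hηθ hξ, ?_⟩ rfl
    (kappa_le γ ξ) (rateFunction_eq hγ1 (kappa_pos hγ hξ).ne' hmin (hσ.trans hmax.symm) β)
  simp only [sliceParameters, hmax]
  linear_combination (kappa γ ξ - γ ^ 2) * -hσ

lemma recoveredFromSecond_sliceParameters {γ η θ β ξ : ℝ} (hγ : γ ≠ 0) (hγ1 : γ ^ 2 ≤ 1)
    (hη : 0 < η) (hθ : 0 < θ) (hβ : 0 ≤ β) (hηθ : η ≠ θ) (hξ : ξ ∈ Ioo (-γ ^ 2) 1)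
    (hmin : pochhammerExponent γ η θ ξ = min η θ) :
    RecoveredFromSecond γ η θ β ξ (min η θ) (sliceParameters γ η θ ξ) := by
  refine recoveredFromSecond hβ ⟨sliceParameters_standing hγ hγ1 hη hθ hηθ hξ, ?_⟩ rfl
    (kappa_le γ ξ) (rateFunction_eq hγ1 (kappa_pos hγ hξ).ne' (lt_min hη hθ).ne'
      ((mul_one _).trans hmin.symm) β)
  simp only [sliceParameters, hmin]
  ring

lemma recoveredFromFirst_of_lt {γ η θ β ξ : ℝ} (hγ : 0 < γ) (hγ1 : γ ≤ 1) (hη : 0 < η)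
    (hlt : η < θ) (hβ : 0 ≤ β) (hξ : -γ ^ 2 < ξ) (hξγ : ξ ≤ 1 - γ ^ 2) :
    RecoveredFromFirst γ η θ β ξ η (sliceParameters γ η θ ξ) := by
  have hγ2 : γ ^ 2 ≤ 1 := pow_le_one₀ hγ.le hγ1
  have hγ0 : 0 < γ ^ 2 := pow_pos hγ 2
  have hexp : pochhammerExponent γ η θ ξ = max η θ :=
    (if_pos hξγ).trans (max_eq_right hlt.le).symm
  simpa only [min_eq_left hlt.le] using
    recoveredFromFirst_sliceParameters hγ.ne' hγ2 hη (hη.trans hlt) hβ hlt.ne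
      ⟨hξ, by linarith⟩ hexp

lemma recoveredFromSecond_of_lt {γ η θ β ξ : ℝ} (hγ : 0 < γ) (hγ1 : γ ≤ 1) (hη : 0 < η)
    (hlt : η < θ) (hβ : 0 ≤ β) (hξγ : 1 - γ ^ 2 < ξ) (hξ : ξ < 1) :
    RecoveredFromSecond γ η θ β ξ η (sliceParameters γ η θ ξ) := by
  have hγ2 : γ ^ 2 ≤ 1 := pow_le_one₀ hγ.le hγ1
  have hexp : pochhammerExponent γ η θ ξ = min η θ :=
    (if_neg hξγ.not_ge).trans (min_eq_left hlt.le).symm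
  simpa only [min_eq_left hlt.le] using
    recoveredFromSecond_sliceParameters hγ.ne' hγ2 hη (hη.trans hlt) hβ hlt.ne
      ⟨by linarith, hξ⟩ hexp

lemma recoveredFromSecond_of_gt {γ η θ β ξ : ℝ} (hγ : 0 < γ) (hγ1 : γ ≤ 1) (hθ : 0 < θ)
    (hlt : θ < η) (hβ : 0 ≤ β) (hξ : -γ ^ 2 < ξ) (hξγ : ξ ≤ 1 - γ ^ 2) :
    RecoveredFromSecond γ η θ β ξ θ (sliceParameters γ η θ ξ) := by
  have hγ2 : γ ^ 2 ≤ 1 := pow_le_one₀ hγ.le hγ1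
  have hγ0 : 0 < γ ^ 2 := pow_pos hγ 2
  have hexp : pochhammerExponent γ η θ ξ = min η θ :=
    (if_pos hξγ).trans (min_eq_right hlt.le).symm
  simpa only [min_eq_right hlt.le] using
    recoveredFromSecond_sliceParameters hγ.ne' hγ2 (hθ.trans hlt) hθ hβ hlt.ne'
      ⟨hξ, by linarith⟩ hexp

lemma recoveredFromFirst_of_gt {γ η θ β ξ : ℝ} (hγ : 0 < γ) (hγ1 : γ ≤ 1) (hθ : 0 < θ)
    (hlt : θ < η) (hβ : 0 ≤ β) (hξγ : 1 - γ ^ 2 < ξ) (hξ : ξ < 1) :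
    RecoveredFromFirst γ η θ β ξ θ (sliceParameters γ η θ ξ) := by
  have hγ2 : γ ^ 2 ≤ 1 := pow_le_one₀ hγ.le hγ1
  have hexp : pochhammerExponent γ η θ ξ = max η θ :=
    (if_neg hξγ.not_ge).trans (max_eq_left hlt.le).symm
  simpa only [min_eq_right hlt.le] using
    recoveredFromFirst_sliceParameters hγ.ne' hγ2 (hθ.trans hlt) hθ hβ hlt.ne'
      ⟨by linarith, hξ⟩ hexp

end MuttalibBorodin

theorem corollary1p3 (γ η θ β : ℝ) (hγ : 0 < γ) (hγ1 : γ ≤ 1) (hη : 0 < η) (hθ : 0 < θ)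
    (hβ : 0 ≤ β) (ξ : ℝ) :
    (η < θ →
      (ξ ∈ Set.Ioc (-γ ^ 2) 0 →
        MuttalibBorodin.RecoveredFromFirst γ η θ β ξ η
          { ν := θ / η, κ := γ ^ 2 - |ξ|, m₁ := |ξ| / (γ ^ 2 - |ξ|),
            n₁ := -|ξ|, n₂ := 1 - γ ^ 2, α := θ, ρ := η }) ∧
      (ξ ∈ Set.Ioc 0 (1 - γ ^ 2) →
        MuttalibBorodin.RecoveredFromFirst γ η θ β ξ η
          { ν := θ / η, κ := γ ^ 2, m₁ := θ * ξ / (η * γ ^ 2),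
            n₁ := 0, n₂ := 1 - γ ^ 2 - ξ, α := θ, ρ := η }) ∧
      (ξ ∈ Set.Ioo (1 - γ ^ 2) 1 →
        MuttalibBorodin.RecoveredFromSecond γ η θ β ξ η
          { ν := θ / η, κ := 1 - ξ, m₁ := θ * ξ / (η * (1 - ξ)),
            n₁ := 1 - γ ^ 2 - ξ, n₂ := 0, α := η, ρ := η })) ∧
    (θ < η →
      (ξ ∈ Set.Ioc (-γ ^ 2) 0 →
        MuttalibBorodin.RecoveredFromSecond γ η θ β ξ θ
          { ν := η / θ, κ := γ ^ 2 - |ξ|, m₁ := |ξ| * η / ((γ ^ 2 - |ξ|) * θ),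
            n₁ := -|ξ|, n₂ := 1 - γ ^ 2, α := θ, ρ := θ }) ∧
      (ξ ∈ Set.Ioc 0 (1 - γ ^ 2) →
        MuttalibBorodin.RecoveredFromSecond γ η θ β ξ θ
          { ν := η / θ, κ := γ ^ 2, m₁ := ξ / γ ^ 2,
            n₁ := 0, n₂ := 1 - γ ^ 2 - ξ, α := θ, ρ := θ }) ∧
      (ξ ∈ Set.Ioo (1 - γ ^ 2) 1 →
        MuttalibBorodin.RecoveredFromFirst γ η θ β ξ θ
          { ν := η / θ, κ := 1 - ξ, m₁ := ξ / (1 - ξ),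
            n₁ := 1 - γ ^ 2 - ξ, n₂ := 0, α := η, ρ := θ })) := by
  have hγ2 : γ ^ 2 ≤ 1 := pow_le_one₀ hγ.le hγ1
  refine ⟨fun hlt => ⟨fun ⟨hl, hr⟩ => ?_, fun ⟨hl, hr⟩ => ?_, fun ⟨hl, hr⟩ => ?_⟩,
    fun hlt => ⟨fun ⟨hl, hr⟩ => ?_, fun ⟨hl, hr⟩ => ?_, fun ⟨hl, hr⟩ => ?_⟩⟩
  · have h := MuttalibBorodin.recoveredFromFirst_of_lt hγ hγ1 hη hlt hβ hl (by linarith)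
    rwa [MuttalibBorodin.sliceParameters_of_nonpos hγ2 hr, max_eq_right hlt.le,
      min_eq_left hlt.le, mul_comm η, mul_div_mul_right _ _ hη.ne'] at h
  · have h := MuttalibBorodin.recoveredFromFirst_of_lt hγ hγ1 hη hlt hβ
      (by linarith [sq_nonneg γ]) hr
    rwa [MuttalibBorodin.sliceParameters_of_pos_of_le hl hr, max_eq_right hlt.le,
      min_eq_left hlt.le, mul_comm (γ ^ 2)] at h
  · have h := MuttalibBorodin.recoveredFromSecond_of_lt hγ hγ1 hη hlt hβ hl hr
    rwa [MuttalibBorodin.sliceParameters_of_pos_of_lt (by linarith) hl, max_eq_right hlt.le,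
      min_eq_left hlt.le, mul_comm (1 - ξ)] at h
  · have h := MuttalibBorodin.recoveredFromSecond_of_gt hγ hγ1 hθ hlt hβ hl (by linarith)
    rwa [MuttalibBorodin.sliceParameters_of_nonpos hγ2 hr, max_eq_left hlt.le,
      min_eq_right hlt.le, mul_comm η] at h
  · have h := MuttalibBorodin.recoveredFromSecond_of_gt hγ hγ1 hθ hlt hβ
      (by linarith [sq_nonneg γ]) hr
    rwa [MuttalibBorodin.sliceParameters_of_pos_of_le hl hr, max_eq_left hlt.le,
      min_eq_right hlt.le, mul_comm θ, mul_div_mul_right _ _ hθ.ne'] at h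
  · have h := MuttalibBorodin.recoveredFromFirst_of_gt hγ hγ1 hθ hlt hβ hl hr
    rwa [MuttalibBorodin.sliceParameters_of_pos_of_lt (by linarith) hl, max_eq_left hlt.le,
      min_eq_right hlt.le, mul_comm θ, mul_div_mul_right _ _ hθ.ne'] at h
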